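/- **Setting.** Let $n_t>n_r>n_j\ge 0$ and $0\le n_e\le n_t-n_r$ be integers, $d_s=n_r-n_j$, $N=2n_r(n_t-n_r)$, and let the entries of the random channel matrices $H_d\in\mathbb C^{n_r\times n_t}$, $H_j\in\mathbb C^{n_r\times n_j}$, $H_e\in\mathbb C^{n_e\times n_t}$ be i.i.d. from a continuous (atomless) distribution on $\mathbb C$. Let $0<\rho<1$, $\sigma,\bar\sigma>0$, let $B\in\mathbb C^{n_t\times d_s}$ be a fixed matrix with $B^*B=I$, and let the signal covariance $K(P)\in\mathbb C^{n_r\times n_r}$ at transmit power $P$ satisfy $c_0P\,I\preceq K(P)\preceq c_1P\,I$ for all large $P$, with constants $c_0,c_1\in(0,1/n_r]$. For each $P$, let $\mathcal S_P=\{S_1,\dots,S_{2^{N_f}}\}$, with $N_f=N_f(P)\in\mathbb N$ feedback bits, be a codebook of $n_t\times n_r$ matrices with orthonormal columns. It is a sphere packing for the chordal distance $d_c(S,F)=\frac1{\sqrt2}\|SS^*-FF^*\|_F$ that is saturated: every matrix with orthonormal columns is at distance at most $\min_{a\ne b}d_c(S_a,S_b)$ from some codeword. Given the channels, let $V\in\mathbb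 C^{n_r\times d_s}$ satisfy $V^*V=I$, $V^*H_j=0$; let $H_d^*=FC$ with $F\in\mathbb C^{n_t\times n_r}$, $F^*F=I$, $C$ invertible; let $\hat F\in\arg\min_{S\in\mathcal S_P}d_c(S,F)$; and put $G^*=B^*FCV(V^*C^*CV)^{-1}$. The perfect-CSI precoders $W_1\in\mathbb C^{n_t\times n_r}$, $W_2\in\mathbb C^{n_t\times(n_t-n_r)}$ form a unitary matrix $[W_1|W_2]$ with $H_dW_2=0$ (they may be chosen depending on $P$). The quantized-CSI precoders are $W_{1,Q}=\hat F$ and $W_{2,Q}\in\mathbb C^{n_t\times(n_t-n_r)}$ with $W_{2,Q}^*W_{2,Q}=I$, $\hat F^*W_{2,Q}=0$. With $Z=G^*V^*H_d$, $\alpha=\frac{(1-\rho)P}{n_t-n_r}$, $\log=\log_2$, and $$T_-(W,W')=\log\frac{\det(\rho H_eWKW^*H_e^*+\alpha H_eW'W'^*H_e^*+\bar\sigma^2I)}{\det(\alpha H_eW'W'^*H_e^*+\bar\sigma^2I)},$$ the secrecy rates under perfect and quantized CSI are $$R^P_{s,G}=\log\frac{\det(\rho ZW_1KW_1^*Z^*+\sigma^2G^*G)}{\det(\sigma^2G^*G)}-T_-(W_1,W_2),$$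 $$R^Q_{s,G}=\log\frac{\det(\rho ZW_{1,Q}KW_{1,Q}^*Z^*+\alpha ZW_{2,Q}W_{2,Q}^*Z^*+\sigma^2G^*G)}{\det(\alpha ZW_{2,Q}W_{2,Q}^*Z^*+\sigma^2G^*G)}-T_-(W_{1,Q},W_{2,Q}).$$ **Theorem 2.** 1. If $N_f=\frac N2\log_2P$ for all large $P$ (up to rounding, i.e. with an error of at most one bit), then almost surely, for all choices above, $\lim_{P\to\infty}R^Q_{s,G}/\log P=\lim_{P\to\infty}R^P_{s,G}/\log P=n_r-n_j$. 2. If, for some $\epsilon>0$, $N_f=(1+\epsilon)\frac N2\log_2P$ for all large $P$ (up to rounding, as before), then almost surely, for all choices above, the conclusion of 1 holds, and moreover $\lim_{P\to\infty}(R^P_{s,G}-R^Q_{s,G})=0$ provided that one of the following holds: (a) the signal covariance is asymptotically isotropic, $K(P)/P\to cI$ for some $c$; or (b) $K$ is arbitrary as above, and $W_1=W_1(P)$ is the orthonormal basis of $\mathrm{Col}(H_d^*)$ matched to $\hat F$, in the sense that $\hat F^*W_1\succeq0$ for all large $P$. -/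

import Mathlib

open MeasureTheory ProbabilityTheory Filter Topology Matrix
open scoped ComplexOrder

noncomputable section

namespace SecureMIMO

/-- All the entries of the three channel matrices, as one family of complex random variables. -/
def channelEntry {Ω : Type*} {nt nr nj ne : ℕ}
    (Hd : Ω → Matrix (Fin nr) (Fin nt) ℂ) (Hj : Ω → Matrix (Fin nr) (Fin nj) ℂ)
    (He : Ω → Matrix (Fin ne) (Fin nt) ℂ) :
    (Fin nr × Fin nt) ⊕ (Fin nr × Fin nj) ⊕ (Fin ne × Fin nt) → Ω → ℂ
  | Sum.inl p => fun ω => Hd ω p.1 p.2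
  | Sum.inr (Sum.inl p) => fun ω => Hj ω p.1 p.2
  | Sum.inr (Sum.inr p) => fun ω => He ω p.1 p.2

/-- The entries of the channel matrices are drawn i.i.d. from one continuous
(i.e. atomless) distribution on `ℂ`. -/
structure IIDContinuousChannels {Ω : Type*} [MeasurableSpace Ω] (Pr : Measure Ω)
    {nt nr nj ne : ℕ}
    (Hd : Ω → Matrix (Fin nr) (Fin nt) ℂ) (Hj : Ω → Matrix (Fin nr) (Fin nj) ℂ)
    (He : Ω → Matrix (Fin ne) (Fin nt) ℂ) : Prop where
  measurable : ∀ i, Measurable (channelEntry Hd Hj He i)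
  indep : iIndepFun (channelEntry Hd Hj He) Pr
  law : ∃ μ : Measure ℂ, (∀ z, μ {z} = 0) ∧ ∀ i, Pr.map (channelEntry Hd Hj He i) = μ

/-- Truncated unitary matrix: the columns are orthonormal. -/
def IsTruncatedUnitary {m n : ℕ} (W : Matrix (Fin m) (Fin n) ℂ) : Prop :=
  Wᴴ * W = 1

/-- Frobenius norm of a complex matrix. -/
def frobNorm {m n : ℕ} (A : Matrix (Fin m) (Fin n) ℂ) : ℝ :=
  Real.sqrt (∑ i, ∑ j, ‖A i j‖ ^ 2)

/-- Chordal distance between the column spaces of two truncated unitary matrices. -/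
def chordalDist {m n : ℕ} (S F : Matrix (Fin m) (Fin n) ℂ) : ℝ :=
  1 / Real.sqrt 2 * frobNorm (S * Sᴴ - F * Fᴴ)

/-- A sphere-packing codebook in the Grassmann manifold of `n`-dimensional subspaces of `ℂ^m`:
the codewords are truncated unitary matrices, and the packing is saturated, i.e. no point of the
manifold lies farther from all the codewords than the codewords lie from one another, so that no
further ball whose radius is half of the minimum distance (or larger) fits strictly between the
balls around the codewords. -/
structure IsSpherePackingCodebook {m n k : ℕ} (S : Fin k → Matrix (Fin m) (Fin n) ℂ) : Prop where
  truncatedUnitary : ∀ i, IsTruncatedUnitary (S i)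
  saturated : ∀ X : Matrix (Fin m) (Fin n) ℂ, IsTruncatedUnitary X →
    ∃ i, ∀ a b, a ≠ b → chordalDist (S i) X ≤ chordalDist (S a) (S b)

/-- `Fhat` is a codeword at minimum chordal distance from `F`. -/
def IsQuantization {m n k : ℕ} (S : Fin k → Matrix (Fin m) (Fin n) ℂ)
    (F Fhat : Matrix (Fin m) (Fin n) ℂ) : Prop :=
  ∃ i, Fhat = S i ∧ ∀ a, chordalDist (S i) F ≤ chordalDist (S a) F

/-- The objects of the transmission scheme for fixed channel matrices `Hd`, `Hj` and codebooks
`S P`: the jammer-nulling filter `V`, the factors of `Hdᴴ = F * C`, the quantized factor `Fhat P`,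
the precoders `(W1, W2)` under perfect CSI, and the precoders `(Fhat, W2Q)` under quantized CSI. -/
structure IsScheme {nt nr nj : ℕ} {Nf : ℝ → ℕ}
    (Hd : Matrix (Fin nr) (Fin nt) ℂ) (Hj : Matrix (Fin nr) (Fin nj) ℂ)
    (S : (P : ℝ) → Fin (2 ^ Nf P) → Matrix (Fin nt) (Fin nr) ℂ)
    (V : Matrix (Fin nr) (Fin (nr - nj)) ℂ)
    (F : Matrix (Fin nt) (Fin nr) ℂ) (C : Matrix (Fin nr) (Fin nr) ℂ)
    (Fhat : ℝ → Matrix (Fin nt) (Fin nr) ℂ)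
    (W1 : ℝ → Matrix (Fin nt) (Fin nr) ℂ) (W2 : ℝ → Matrix (Fin nt) (Fin (nt - nr)) ℂ)
    (W2Q : ℝ → Matrix (Fin nt) (Fin (nt - nr)) ℂ) : Prop where
  V_unitary : IsTruncatedUnitary V
  V_null : Vᴴ * Hj = 0
  F_unitary : IsTruncatedUnitary F
  C_invertible : IsUnit C
  qr : Hdᴴ = F * C
  quantization : ∀ P, IsQuantization (S P) F (Fhat P)
  W1_unitary : ∀ P, IsTruncatedUnitary (W1 P)
  W2_unitary : ∀ P, IsTruncatedUnitary (W2 P)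
  W1_orth_W2 : ∀ P, (W1 P)ᴴ * W2 P = 0
  W2_null : ∀ P, Hd * W2 P = 0
  W2Q_unitary : ∀ P, IsTruncatedUnitary (W2Q P)
  W2Q_null : ∀ P, (Fhat P)ᴴ * W2Q P = 0

/-- The second receive filter `G`, with `Gᴴ = Bᴴ F C V (Vᴴ Cᴴ C V)⁻¹`. -/
def receiveFilter {nt nr ds : ℕ} (B : Matrix (Fin nt) (Fin ds) ℂ)
    (F : Matrix (Fin nt) (Fin nr) ℂ) (C : Matrix (Fin nr) (Fin nr) ℂ)
    (V : Matrix (Fin nr) (Fin ds) ℂ) : Matrix (Fin ds) (Fin ds) ℂ :=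
  (Bᴴ * F * C * V * (Vᴴ * Cᴴ * C * V)⁻¹)ᴴ

/-- Power of one artificial-noise stream: `(1 - ρ) P / (nt - nr)`. -/
def noisePower (nt nr : ℕ) (ρ P : ℝ) : ℝ :=
  (1 - ρ) * P / ((nt : ℝ) - (nr : ℝ))

/-- Covariance at a receiver with (effective) channel `H` of the information-bearing signal. -/
def signalCov {n nt nr : ℕ} (ρ : ℝ) (K : Matrix (Fin nr) (Fin nr) ℂ)
    (H : Matrix (Fin n) (Fin nt) ℂ) (W1 : Matrix (Fin nt) (Fin nr) ℂ) :
    Matrix (Fin n) (Fin n) ℂ :=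
  (ρ : ℂ) • (H * W1 * K * W1ᴴ * Hᴴ)

/-- Covariance at a receiver with (effective) channel `H` of the artificial noise. -/
def artificialNoiseCov {n nt : ℕ} (nr : ℕ) (ρ P : ℝ)
    (H : Matrix (Fin n) (Fin nt) ℂ) (W2 : Matrix (Fin nt) (Fin (nt - nr)) ℂ) :
    Matrix (Fin n) (Fin n) ℂ :=
  (noisePower nt nr ρ P : ℂ) • (H * W2 * W2ᴴ * Hᴴ)

/-- `T₋`: the rate (in bits) of the eavesdropper. -/
def eveRate {nt nr ne : ℕ} (ρ σe P : ℝ) (K : Matrix (Fin nr) (Fin nr) ℂ)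
    (He : Matrix (Fin ne) (Fin nt) ℂ) (W1 : Matrix (Fin nt) (Fin nr) ℂ)
    (W2 : Matrix (Fin nt) (Fin (nt - nr)) ℂ) : ℝ :=
  Real.logb 2
    ((signalCov ρ K He W1 + artificialNoiseCov nr ρ P He W2
        + ((σe ^ 2 : ℝ) : ℂ) • (1 : Matrix (Fin ne) (Fin ne) ℂ)).det.re /
      (artificialNoiseCov nr ρ P He W2
        + ((σe ^ 2 : ℝ) : ℂ) • (1 : Matrix (Fin ne) (Fin ne) ℂ)).det.re)

/-- The secrecy rate `R_{s,G}^P` (in bits) under perfect CSI: there is no leakage. -/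
def ratePerfect {nt nr ne ds : ℕ} (ρ σ σe P : ℝ) (K : Matrix (Fin nr) (Fin nr) ℂ)
    (Hd : Matrix (Fin nr) (Fin nt) ℂ) (He : Matrix (Fin ne) (Fin nt) ℂ)
    (V : Matrix (Fin nr) (Fin ds) ℂ) (G : Matrix (Fin ds) (Fin ds) ℂ)
    (W1 : Matrix (Fin nt) (Fin nr) ℂ) (W2 : Matrix (Fin nt) (Fin (nt - nr)) ℂ) : ℝ :=
  Real.logb 2
    ((signalCov ρ K (Gᴴ * Vᴴ * Hd) W1 + ((σ ^ 2 : ℝ) : ℂ) • (Gᴴ * G)).det.re /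
      (((σ ^ 2 : ℝ) : ℂ) • (Gᴴ * G)).det.re)
    - eveRate ρ σe P K He W1 W2

/-- The secrecy rate `R_{s,G}^Q` (in bits) under quantized CSI, with precoders `W1Q`, `W2Q`. -/
def rateQuantized {nt nr ne ds : ℕ} (ρ σ σe P : ℝ) (K : Matrix (Fin nr) (Fin nr) ℂ)
    (Hd : Matrix (Fin nr) (Fin nt) ℂ) (He : Matrix (Fin ne) (Fin nt) ℂ)
    (V : Matrix (Fin nr) (Fin ds) ℂ) (G : Matrix (Fin ds) (Fin ds) ℂ)
    (W1Q : Matrix (Fin nt) (Fin nr) ℂ) (W2Q : Matrix (Fin nt) (Fin (nt - nr)) ℂ) : ℝ :=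
  Real.logb 2
    ((signalCov ρ K (Gᴴ * Vᴴ * Hd) W1Q + artificialNoiseCov nr ρ P (Gᴴ * Vᴴ * Hd) W2Q
        + ((σ ^ 2 : ℝ) : ℂ) • (Gᴴ * G)).det.re /
      (artificialNoiseCov nr ρ P (Gᴴ * Vᴴ * Hd) W2Q
        + ((σ ^ 2 : ℝ) : ℂ) • (Gᴴ * G)).det.re)
    - eveRate ρ σe P K He W1Q W2Q

/-- The feedback rate scaling `Nf = (1 + ε) (N / 2) log₂ P` with `N = 2 nr (nt - nr)`; since a
number of bits is an integer, the equation is understood up to rounding (in either direction). -/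
def FeedbackScaling (nt nr : ℕ) (ε : ℝ) (Nf : ℝ → ℕ) : Prop :=
  ∀ᶠ P : ℝ in atTop,
    |(Nf P : ℝ) - (1 + ε) * ((2 * nr * ((nt : ℝ) - nr)) / 2) * Real.logb 2 P| ≤ 1

/-- A secrecy rate `R P` attains `d` secure degrees of freedom. -/
def HasSDoF (R : ℝ → ℝ) (d : ℝ) : Prop :=
  Tendsto (fun P => R P / Real.logb 2 P) atTop (𝓝 d)

end SecureMIMO

end

/-! The Grassmannian of `nr`-planes in `ℂ^nt` has real dimension `N = 2 nr (nt - nr)`, so among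
about `P^((1+ε)N/2)` codewords two lie within `O(P^(-(1+ε)/2))` of each other
(`exists_chordalDist_le_of_card_lt`). Saturation turns this minimum distance into a bound on the
quantization error. The artificial noise leaking to the receiver is `P` times the square of that
error. It is therefore `O(P^(-ε))`: bounded if `ε = 0`, vanishing if `ε > 0`.

Almost surely two nondegeneracy conditions hold: `Vᴴ Hd B` is invertible, and `He` has a right
inverse with columns in the kernel of `Hd`. Both follow from the nonvanishing of a determinant that
is a nonzero polynomial in independent atomless variables. The first keeps the receiver's signal at
full rank `nr - nj`; the second lets the artificial noise fill the eavesdropper's whole space, so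
that the eavesdropper's rate stays bounded.

The covariance `K/P`, the precoders and the scaled error `√P (FFᴴ - F̂F̂ᴴ)F` are bounded but need
not converge. Hence limits are taken along ultrafilters finer than `atTop`
(`IsScheme.exists_limits`). Along each of them either rate is `(nr - nj) log P` plus a convergent
term (`tendsto_rateQuantized_sub`), which gives the degrees of freedom. If `ε > 0`, the two limiting
constants can differ only through `W₀ K₀ W₀ᴴ` and `F₀ K₀ F₀ᴴ`, where `W₀` and `F₀` span the same
space. These agree if `K₀` is scalar, or if matching forces `W₀ = F₀`. -/

namespace SecureMIMO

/-! ### Zero sets of polynomials in independent atomless variables -/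

section GenericPolynomial

/-- Induction by Fubini: the leading coefficient in the first variable is a nonzero polynomial in
the others, hence almost surely nonzero; then only finitely many values of the first variable are
roots, and atomless measures ignore them. -/
theorem measure_pi_zeroLocus_fin {n : ℕ} (μ : Fin n → Measure ℂ)
    [∀ i, IsProbabilityMeasure (μ i)] [∀ i, NullSingletonClass (μ i)]
    (p : MvPolynomial (Fin n) ℂ) (hp : p ≠ 0) :
    Measure.pi μ {x | MvPolynomial.eval x p = 0} = 0 := by
  induction n with
  | zero =>
    have : {x : Fin 0 → ℂ | MvPolynomial.eval x p = 0} = ∅ := by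
      ext x
      rw [MvPolynomial.eq_C_of_isEmpty p] at hp ⊢
      simpa using hp
    rw [this, measure_empty]
  | succ n ih =>
    have hcont : Continuous fun z : ℂ × (Fin n → ℂ) =>
        MvPolynomial.eval (Fin.cons z.1 z.2 : Fin (n + 1) → ℂ) p := by
      have h1 : Continuous fun z : ℂ × (Fin n → ℂ) => (Fin.cons z.1 z.2 : Fin (n + 1) → ℂ) :=
        Continuous.finCons (A := fun _ => ℂ) continuous_fst continuous_snd
      exact (MvPolynomial.continuous_eval p).comp h1
    set s : Set (ℂ × (Fin n → ℂ)) :=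
      {z | MvPolynomial.eval (Fin.cons z.1 z.2 : Fin (n + 1) → ℂ) p = 0} with hs
    have hsm : MeasurableSet s := (isClosed_eq hcont continuous_const).measurableSet
    have hmp := measurePreserving_piFinSuccAbove μ 0
    have hpre : {x | MvPolynomial.eval x p = 0} =
        (MeasurableEquiv.piFinSuccAbove (fun _ : Fin (n + 1) => ℂ) 0) ⁻¹' s := by
      ext x
      have : (Fin.cons (x 0) (fun j : Fin n => x (Fin.succ j)) : Fin (n + 1) → ℂ) = x :=
        Fin.cons_self_tail x
      simp [hs, MeasurableEquiv.piFinSuccAbove, Fin.insertNthEquiv]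
    -- The swap makes the slices run over variable 0 with the remaining variables fixed.
    rw [hpre, hmp.measure_preimage hsm.nullMeasurableSet, ← Measure.prod_swap,
      Measure.map_apply measurable_swap hsm, Measure.measure_prod_null (measurable_swap hsm)]
    set q := MvPolynomial.finSuccEquiv ℂ n p with hq
    have hq0 : q ≠ 0 := by simpa [hq] using hp
    have hlead := ih (fun j => μ (Fin.succAbove 0 j)) q.leadingCoeff
      (Polynomial.leadingCoeff_ne_zero.mpr hq0)
    have hae : ∀ᵐ x ∂(Measure.pi fun j => μ (Fin.succAbove 0 j)),
        MvPolynomial.eval x q.leadingCoeff ≠ 0 := by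
      rw [ae_iff]; simpa using hlead
    filter_upwards [hae] with x hx
    have hmap : Polynomial.map (MvPolynomial.eval x) q ≠ 0 := by
      intro h
      apply hx
      have := congrArg (fun r => Polynomial.coeff r q.natDegree) h
      simpa [Polynomial.coeff_map] using this
    refine Set.Finite.measure_zero (Set.Finite.subset
      (Polynomial.map (MvPolynomial.eval x) q).roots.toFinset.finite_toSet ?_) _
    intro y hy
    have hy' : MvPolynomial.eval (Fin.cons y x : Fin (n + 1) → ℂ) p = 0 := hy
    rw [MvPolynomial.eval_eq_eval_mv_eval'] at hy'
    simpa [hmap] using hy'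

/-- A nonzero polynomial in independent atomless random variables almost surely does not vanish. -/
theorem ae_eval_ne_zero {Ω ι : Type*} [MeasurableSpace Ω] [Fintype ι] {Pr : Measure Ω}
    [IsProbabilityMeasure Pr] {X : ι → Ω → ℂ} (hX : ∀ i, Measurable (X i))
    (hind : iIndepFun X Pr) (hatom : ∀ i, NullSingletonClass (Pr.map (X i)))
    (p : MvPolynomial ι ℂ) (hp : p ≠ 0) :
    ∀ᵐ ω ∂Pr, MvPolynomial.eval (fun i => X i ω) p ≠ 0 := by
  let e := Fintype.equivFin ι
  have hprob : ∀ j, IsProbabilityMeasure (Pr.map (X (e.symm j))) := fun j =>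
    Measure.isProbabilityMeasure_map (hX _).aemeasurable
  have hnull := measure_pi_zeroLocus_fin (fun j => Pr.map (X (e.symm j)))
    (MvPolynomial.rename e p)
    (by rwa [Ne, map_eq_zero_iff _ (MvPolynomial.rename_injective _ e.injective)])
  have hind' : iIndepFun (fun j => X (e.symm j)) Pr := hind.precomp e.symm.injective
  rw [← (iIndepFun_iff_map_fun_eq_pi_map fun j => (hX (e.symm j)).aemeasurable).mp hind',
    Measure.map_apply (measurable_pi_lambda _ fun j => hX _)
      (isClosed_eq (MvPolynomial.continuous_eval _) continuous_const).measurableSet] at hnull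
  rw [ae_iff]
  convert hnull using 2
  ext ω
  simp [MvPolynomial.eval_rename, Function.comp_def]

/-- A determinant with polynomial entries in independent atomless random variables is almost surely
nonzero, provided that it is nonzero for some values of the variables. -/
theorem ae_det_ne_zero {Ω ι κ : Type*} [MeasurableSpace Ω] [Fintype ι] [Fintype κ] [DecidableEq κ]
    {Pr : Measure Ω} [IsProbabilityMeasure Pr] {X : ι → Ω → ℂ} (hX : ∀ i, Measurable (X i))
    (hind : iIndepFun X Pr) (hatom : ∀ i, NullSingletonClass (Pr.map (X i)))
    (M : Matrix κ κ (MvPolynomial ι ℂ)) (x₀ : ι → ℂ)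
    (hx₀ : (M.map (MvPolynomial.eval x₀)).det ≠ 0) :
    ∀ᵐ ω ∂Pr, (M.map (MvPolynomial.eval fun i => X i ω)).det ≠ 0 := by
  have hev : ∀ x : ι → ℂ, MvPolynomial.eval x M.det = (M.map (MvPolynomial.eval x)).det :=
    fun x => RingHom.map_det _ _
  have hp : M.det ≠ 0 := by
    intro h
    apply hx₀
    rw [← hev, h, map_zero]
  filter_upwards [ae_eval_ne_zero hX hind hatom _ hp] with ω hω
  rwa [← hev]

end GenericPolynomial

/-! ### Almost sure nondegeneracy of the channels -/

section GenericChannels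

theorem IIDContinuousChannels.nullSingletonClass {Ω : Type*} [MeasurableSpace Ω] {Pr : Measure Ω}
    {nt nr nj ne : ℕ} {Hd : Ω → Matrix (Fin nr) (Fin nt) ℂ}
    {Hj : Ω → Matrix (Fin nr) (Fin nj) ℂ} {He : Ω → Matrix (Fin ne) (Fin nt) ℂ}
    (hH : IIDContinuousChannels Pr Hd Hj He) :
    ∀ i, NullSingletonClass (Pr.map (channelEntry Hd Hj He i)) := by
  obtain ⟨μ, hμ, hlaw⟩ := hH.law
  intro i
  rw [hlaw i]
  exact ⟨hμ⟩

variable {Ω : Type*} [MeasurableSpace Ω] {Pr : Measure Ω} [IsProbabilityMeasure Pr]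
  {nt nr nj ne : ℕ} {Hd : Ω → Matrix (Fin nr) (Fin nt) ℂ} {Hj : Ω → Matrix (Fin nr) (Fin nj) ℂ}
  {He : Ω → Matrix (Fin ne) (Fin nt) ℂ}

/-- Almost surely, nulling the jammer keeps the image of `Hd * B` at full dimension. -/
theorem IIDContinuousChannels.ae_isUnit_filtered_channel (hH : IIDContinuousChannels Pr Hd Hj He)
    (hjr : nj < nr) {B : Matrix (Fin nt) (Fin (nr - nj)) ℂ} (hB : IsTruncatedUnitary B) :
    ∀ᵐ ω ∂Pr, ∀ V : Matrix (Fin nr) (Fin (nr - nj)) ℂ, IsTruncatedUnitary V →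
      Vᴴ * Hj ω = 0 → IsUnit (Vᴴ * Hd ω * B) := by
  let e : Fin nr ≃ Fin (nr - nj) ⊕ Fin nj := Fintype.equivOfCardEq (by simp; omega)
  let hd : Matrix (Fin nr) (Fin nt)
      (MvPolynomial ((Fin nr × Fin nt) ⊕ (Fin nr × Fin nj) ⊕ (Fin ne × Fin nt)) ℂ) :=
    Matrix.of fun i j => MvPolynomial.X (Sum.inl (i, j))
  let hj : Matrix (Fin nr) (Fin nj)
      (MvPolynomial ((Fin nr × Fin nt) ⊕ (Fin nr × Fin nj) ⊕ (Fin ne × Fin nt)) ℂ) :=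
    Matrix.of fun i j => MvPolynomial.X (Sum.inr (Sum.inl (i, j)))
  let b : Matrix (Fin nt) (Fin (nr - nj))
      (MvPolynomial ((Fin nr × Fin nt) ⊕ (Fin nr × Fin nj) ⊕ (Fin ne × Fin nt)) ℂ) :=
    B.map MvPolynomial.C
  let M := (fromCols (hd * b) hj).submatrix id e
  have hM : ∀ x, M.map (MvPolynomial.eval x) = (fromCols
      ((Matrix.of fun i j => x (Sum.inl (i, j))) * B)
      (Matrix.of fun i j => x (Sum.inr (Sum.inl (i, j))))).submatrix id e := by
    intro x
    ext i j
    simp only [M, Matrix.map_apply, submatrix_apply, id]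
    rcases e j with k | k
    · rw [fromCols_apply_inl, fromCols_apply_inl, Matrix.mul_apply, Matrix.mul_apply, map_sum]
      simp [hd, b]
    · simp [hj]
  let X₀ : Matrix (Fin nr) (Fin (nr - nj)) ℂ := (1 : Matrix (Fin nr) (Fin nr) ℂ).submatrix id
    (fun k => e.symm (Sum.inl k))
  -- With `Hd = X₀ Bᴴ`, orthonormality of `B` gives `Hd B = X₀`. The columns of `X₀` and of this
  -- `Hj` are complementary sets of unit vectors, so `[Hd B | Hj]` is the identity up to the column
  -- order `e`.
  let x₀ : (Fin nr × Fin nt) ⊕ (Fin nr × Fin nj) ⊕ (Fin ne × Fin nt) → ℂ :=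
    Sum.elim (fun p => (X₀ * Bᴴ) p.1 p.2)
      (Sum.elim (fun p => (1 : Matrix (Fin nr) (Fin nr) ℂ) p.1 (e.symm (Sum.inr p.2))) 0)
  have h0 : (M.map (MvPolynomial.eval x₀)).det ≠ 0 := by
    have : M.map (MvPolynomial.eval x₀) = 1 := by
      rw [hM]
      have h1 : (Matrix.of fun i j => x₀ (Sum.inl (i, j))) * B = X₀ := by
        have : (Matrix.of fun i j => x₀ (Sum.inl (i, j))) = X₀ * Bᴴ := rfl
        rw [this, Matrix.mul_assoc, hB, Matrix.mul_one]
      rw [h1]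
      ext i j
      obtain ⟨k, rfl⟩ := e.symm.surjective j
      rcases k with k | k 
      · simp only [submatrix_apply, Equiv.apply_symm_apply, fromCols_apply_inl, X₀]
        rfl
      · simp [x₀]
    rw [this, det_one]; exact one_ne_zero
  filter_upwards [ae_det_ne_zero hH.measurable hH.indep hH.nullSingletonClass M x₀ h0]
    with ω hω V hV hVj
  rw [hM] at hω
  set A := fromCols (Hd ω * B) (Hj ω) with hA
  have hAdet : IsUnit (A.submatrix id e).det := isUnit_iff_ne_zero.mpr hω
  have h1 : A * ((A.submatrix id e)⁻¹.submatrix e.symm id) = 1 := by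
    have := Matrix.mul_nonsing_inv _ hAdet
    rw [← this]
    conv_rhs => rw [← Matrix.submatrix_id_id (A.submatrix id e * (A.submatrix id e)⁻¹)]
    rw [← Matrix.submatrix_mul_equiv (A.submatrix id e) (A.submatrix id e)⁻¹ id e.symm id]
    simp
  have h2 : Vᴴ * A = fromCols (Vᴴ * Hd ω * B) 0 := by
    rw [hA, mul_fromCols, hVj, Matrix.mul_assoc]
  set R := (A.submatrix id e)⁻¹.submatrix e.symm id with hR
  -- Since `V` annihilates `Hj`, only the upper block of the right inverse `R` of `[Hd B | Hj]`
  -- survives in `Vᴴ [Hd B | Hj] R V = Vᴴ V = 1`.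
  have h3 : Vᴴ * Hd ω * B * (R.toRows₁ * V) = 1 := by
    have : Vᴴ * A * R * V = 1 := by rw [Matrix.mul_assoc Vᴴ, h1, Matrix.mul_one]; exact hV
    rw [h2, ← fromRows_toRows R, fromCols_mul_fromRows, Matrix.zero_mul, add_zero] at this
    rw [← Matrix.mul_assoc]; exact this
  exact IsUnit.of_mul_eq_one _ h3

/-- Almost surely, the rows of `He` are independent of each other and of those of `Hd`. -/
theorem IIDContinuousChannels.ae_exists_rightInverse (hH : IIDContinuousChannels Pr Hd Hj He)
    (hrt : nr < nt) (hne : ne ≤ nt - nr) :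
    ∀ᵐ ω ∂Pr, ∃ X : Matrix (Fin nt) (Fin ne) ℂ, Hd ω * X = 0 ∧ He ω * X = 1 := by
  -- The bound on `ne` gives the stacked matrix of `Hd` and `He` at least as many columns as rows;
  -- `g` picks the columns of a maximal minor.
  obtain ⟨g⟩ : Nonempty (Fin nr ⊕ Fin ne ↪ Fin nt) :=
    Function.Embedding.nonempty_of_card_le (by simp; omega)
  let M : Matrix (Fin nr ⊕ Fin ne) (Fin nr ⊕ Fin ne)
      (MvPolynomial ((Fin nr × Fin nt) ⊕ (Fin nr × Fin nj) ⊕ (Fin ne × Fin nt)) ℂ) :=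
    (fromRows (Matrix.of fun i j => MvPolynomial.X (Sum.inl (i, j)))
      (Matrix.of fun i j => MvPolynomial.X (Sum.inr (Sum.inr (i, j))))).submatrix id g
  have hM : ∀ x, M.map (MvPolynomial.eval x) = (fromRows
      (Matrix.of fun i j => x (Sum.inl (i, j)))
      (Matrix.of fun i j => x (Sum.inr (Sum.inr (i, j))))).submatrix id g := by
    intro x
    ext i j
    rcases i with i | i <;> simp [M]
  let x₀ : (Fin nr × Fin nt) ⊕ (Fin nr × Fin nj) ⊕ (Fin ne × Fin nt) → ℂ :=
    Sum.elim (fun p => (1 : Matrix (Fin nt) (Fin nt) ℂ) (g (Sum.inl p.1)) p.2)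
      (Sum.elim 0 (fun p => (1 : Matrix (Fin nt) (Fin nt) ℂ) (g (Sum.inr p.1)) p.2))
  have h0 : (M.map (MvPolynomial.eval x₀)).det ≠ 0 := by
    have : M.map (MvPolynomial.eval x₀) = 1 := by
      rw [hM]
      ext i j
      rcases i with i | i <;> simp [x₀, one_apply, g.injective.eq_iff]
    rw [this, det_one]; exact one_ne_zero
  filter_upwards [ae_det_ne_zero hH.measurable hH.indep hH.nullSingletonClass M x₀ h0] with ω hω
  rw [hM] at hω
  set A := fromRows (Hd ω) (He ω) with hA
  have hAdet : IsUnit (A.submatrix id g).det := isUnit_iff_ne_zero.mpr hω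
  -- The inverse of the minor, padded with zero rows, is a right inverse of the stacked matrix; its
  -- last `ne` columns form the required `X`.
  have h1 : A * ((1 : Matrix (Fin nt) (Fin nt) ℂ).submatrix id g * (A.submatrix id g)⁻¹) = 1 := by
    rw [← Matrix.mul_assoc, ← Matrix.mul_nonsing_inv _ hAdet]
    congr 1
    ext i j
    simp [mul_apply, one_apply]
  set R := (1 : Matrix (Fin nt) (Fin nt) ℂ).submatrix id g * (A.submatrix id g)⁻¹ with hR
  rw [hA, fromRows_mul] at h1
  refine ⟨R.submatrix id Sum.inr, ?_, ?_⟩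
  · ext i j
    have := congrFun (congrFun h1 (Sum.inl i)) (Sum.inr j)
    simpa [mul_apply] using this
  · ext i j
    have := congrFun (congrFun h1 (Sum.inr i)) (Sum.inr j)
    simpa [mul_apply, one_apply] using this

end GenericChannels

/-! ### Packing bound on the Grassmannian and the quantization error -/

section Quantization

open scoped Matrix.Norms.Frobenius

theorem frobNorm_eq_norm {m n : ℕ} (A : Matrix (Fin m) (Fin n) ℂ) : frobNorm A = ‖A‖ := by
  rw [frobNorm, Matrix.frobenius_norm_def, Real.sqrt_eq_rpow]
  simp

theorem norm_le_of_entry_le {m n : ℕ} {A : Matrix (Fin m) (Fin n) ℂ} {r : ℝ} (hr : 0 ≤ r)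
    (hA : ∀ i j, ‖A i j‖ ≤ r) : ‖A‖ ≤ m * n * r := by
  rw [← frobNorm_eq_norm, frobNorm]
  refine Real.sqrt_le_iff.mpr ⟨by positivity, ?_⟩
  have h1 : ∑ i, ∑ j, ‖A i j‖ ^ 2 ≤ ∑ _i : Fin m, ∑ _j : Fin n, r ^ 2 :=
    Finset.sum_le_sum fun i _ => Finset.sum_le_sum fun j _ =>
      pow_le_pow_left₀ (norm_nonneg _) (hA i j) 2
  have h2 : ((m * n : ℕ) : ℝ) ≤ ((m * n : ℕ) : ℝ) ^ 2 := by
    exact_mod_cast Nat.le_self_pow two_ne_zero _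
  push_cast at h2
  calc _ ≤ _ := h1
    _ = m * n * r ^ 2 := by simp [mul_assoc]
    _ ≤ ((m : ℝ) * n) ^ 2 * r ^ 2 := by gcongr
    _ = _ := by ring

theorem entry_le_norm {m n : ℕ} (A : Matrix (Fin m) (Fin n) ℂ) (i : Fin m) (j : Fin n) :
    ‖A i j‖ ≤ ‖A‖ := by
  rw [← frobNorm_eq_norm, frobNorm]
  refine Real.le_sqrt_of_sq_le ?_
  exact (Finset.single_le_sum (f := fun j => ‖A i j‖ ^ 2) (fun _ _ => by positivity)
    (Finset.mem_univ j)).trans (Finset.single_le_sum (f := fun i => ∑ j, ‖A i j‖ ^ 2)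
    (fun _ _ => by positivity) (Finset.mem_univ i))

theorem IsTruncatedUnitary.entry_le_one {m n : ℕ} {W : Matrix (Fin m) (Fin n) ℂ}
    (hW : IsTruncatedUnitary W) (i : Fin m) (j : Fin n) : ‖W i j‖ ≤ 1 := by
  have h := congrFun (congrFun hW j) j
  rw [Matrix.mul_apply, Matrix.one_apply_eq] at h
  have h' : ∑ k, ‖W k j‖ ^ 2 = 1 := by
    have : ∀ k, Wᴴ j k * W k j = ((‖W k j‖ ^ 2 : ℝ) : ℂ) := fun k => by
      rw [conjTranspose_apply]
      simpa using Complex.conj_mul' (W k j)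
    simp_rw [this] at h
    exact_mod_cast h
  have := Finset.single_le_sum (f := fun k => ‖W k j‖ ^ 2) (fun _ _ => by positivity)
    (Finset.mem_univ i)
  rw [h'] at this
  exact (sq_le_one_iff₀ (norm_nonneg _)).mp this

theorem IsTruncatedUnitary.norm_le {m n : ℕ} {W : Matrix (Fin m) (Fin n) ℂ}
    (hW : IsTruncatedUnitary W) : ‖W‖ ≤ m * n := by
  simpa using norm_le_of_entry_le zero_le_one hW.entry_le_one

theorem norm_one_le (m : ℕ) : ‖(1 : Matrix (Fin m) (Fin m) ℂ)‖ ≤ m * m :=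
  IsTruncatedUnitary.norm_le (W := (1 : Matrix (Fin m) (Fin m) ℂ)) (by simp [IsTruncatedUnitary])

/-- The projection `1 - S' S'ᴴ` kills `A'`, whose columns span the same space as those of `S'`, so
`A` may be replaced by `A - A'`. No bound on the inverse of `D` or `D'` is needed. -/
theorem norm_oneSubProj_mul_proj_le {m n : ℕ} {S S' A A' : Matrix (Fin m) (Fin n) ℂ}
    {D D' : Matrix (Fin n) (Fin n) ℂ} (hS : IsTruncatedUnitary S) (hS' : IsTruncatedUnitary S')
    (hA : S = A * D) (hA' : S' = A' * D') (hD : ∀ i j, ‖D i j‖ ≤ 1) (hD' : IsUnit D'.det) :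
    ‖(1 - S' * S'ᴴ) * (S * Sᴴ)‖ ≤
      (m * m + m * n * (m * n)) * ‖A - A'‖ * (n * n) * (m * n) := by
  have h0 : (1 - S' * S'ᴴ) * A' = 0 := by
    have h1 : (1 - S' * S'ᴴ) * S' = 0 := by
      rw [Matrix.sub_mul, Matrix.mul_assoc, hS', Matrix.one_mul, Matrix.mul_one, sub_self]
    have h2 : A' = S' * D'⁻¹ := by rw [hA', Matrix.mul_assoc, Matrix.mul_nonsing_inv _ hD',
      Matrix.mul_one]
    rw [h2, ← Matrix.mul_assoc, h1, Matrix.zero_mul]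
  have h1 : (1 - S' * S'ᴴ) * (S * Sᴴ) = (1 - S' * S'ᴴ) * (A - A') * D * Sᴴ := by
    rw [Matrix.mul_sub, h0, sub_zero, Matrix.mul_assoc _ A, ← hA, Matrix.mul_assoc]
  have hDn : ‖D‖ ≤ n * n := by simpa using norm_le_of_entry_le zero_le_one hD
  have hSn : ‖Sᴴ‖ ≤ m * n := by rw [frobenius_norm_conjTranspose]; exact hS.norm_le
  have hP : ‖1 - S' * S'ᴴ‖ ≤ m * m + m * n * (m * n) := by
    refine (norm_sub_le _ _).trans (add_le_add (norm_one_le m) ((frobenius_norm_mul _ _).trans ?_))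
    rw [frobenius_norm_conjTranspose]
    exact mul_le_mul hS'.norm_le hS'.norm_le (norm_nonneg _) (by positivity)
  rw [h1]
  refine (frobenius_norm_mul _ _).trans ?_
  gcongr
  refine (frobenius_norm_mul _ _).trans ?_
  gcongr
  refine (frobenius_norm_mul _ _).trans ?_
  gcongr

/-- Column spaces given by nearby charts are close in chordal distance. -/
theorem chordalDist_le_of_charts {m n : ℕ} {S S' A A' : Matrix (Fin m) (Fin n) ℂ}
    {D D' : Matrix (Fin n) (Fin n) ℂ} (hS : IsTruncatedUnitary S) (hS' : IsTruncatedUnitary S')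
    (hA : S = A * D) (hA' : S' = A' * D') (hD : ∀ i j, ‖D i j‖ ≤ 1) (hD' : ∀ i j, ‖D' i j‖ ≤ 1)
    (hu : IsUnit D.det) (hu' : IsUnit D'.det) :
    chordalDist S S' ≤ 2 * ((m * m + m * n * (m * n)) * (n * n) * (m * n)) * ‖A - A'‖ := by
  have h1 := norm_oneSubProj_mul_proj_le hS hS' hA hA' hD hu'
  have h2 := norm_oneSubProj_mul_proj_le hS' hS hA' hA hD' hu
  rw [norm_sub_rev A' A] at h2
  -- For projections, `p - p' = (1 - p') p - p' (1 - p)`.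
  have hid : S * Sᴴ - S' * S'ᴴ =
      (1 - S' * S'ᴴ) * (S * Sᴴ) - ((1 - S * Sᴴ) * (S' * S'ᴴ))ᴴ := by
    simp only [conjTranspose_mul, conjTranspose_sub, conjTranspose_one, conjTranspose_conjTranspose]
    noncomm_ring
  have h3 : ‖S * Sᴴ - S' * S'ᴴ‖ ≤
      ‖(1 - S' * S'ᴴ) * (S * Sᴴ)‖ + ‖(1 - S * Sᴴ) * (S' * S'ᴴ)‖ := by
    rw [hid, ← frobenius_norm_conjTranspose ((1 - S * Sᴴ) * (S' * S'ᴴ))]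
    exact norm_sub_le _ _
  have h4 : chordalDist S S' ≤ ‖S * Sᴴ - S' * S'ᴴ‖ := by
    rw [chordalDist, frobNorm_eq_norm]
    refine mul_le_of_le_one_left (norm_nonneg _) ?_
    rw [div_le_one (by positivity)]
    exact Real.one_le_sqrt.mpr one_le_two
  linarith

/-- A matrix with orthonormal columns has a nonzero maximal minor. -/
theorem IsTruncatedUnitary.exists_minor_ne_zero {m n : ℕ} {S : Matrix (Fin m) (Fin n) ℂ}
    (hS : IsTruncatedUnitary S) : ∃ f : Fin n → Fin m, (S.submatrix f id).det ≠ 0 := by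
  by_contra! h
  have h1 : (Sᴴ * S).det = 0 := by
    -- As in Cauchy–Binet: expanding multilinearly in the rows writes the Gram determinant as a
    -- combination of maximal minors of `S`.
    have h2 : (Sᴴ * S).det = detRowAlternating (R := ℂ) (fun i => ∑ k, Sᴴ i k • S k) := by
      change _ = Matrix.det _
      congr 1
      ext i j
      simp [Matrix.mul_apply, Finset.sum_apply]
    rw [h2, ← AlternatingMap.coe_multilinearMap, MultilinearMap.map_sum]
    refine Finset.sum_eq_zero fun f _ => ?_
    rw [MultilinearMap.map_smul_univ, AlternatingMap.coe_multilinearMap]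
    exact (congrArg _ (h f)).trans (smul_zero _)
  rw [hS, det_one] at h1
  exact one_ne_zero h1

/-- Every subspace is the graph of a matrix with entries in the unit disc, over some coordinates. -/
theorem IsTruncatedUnitary.exists_chart {m n : ℕ} {S : Matrix (Fin m) (Fin n) ℂ}
    (hS : IsTruncatedUnitary S) : ∃ (f : Fin n ↪ Fin m) (A : Matrix (Fin m) (Fin n) ℂ),
      S = A * S.submatrix f id ∧ IsUnit (S.submatrix f id).det ∧ A.submatrix f id = 1 ∧
      ∀ i j, ‖A i j‖ ≤ 1 := by
  obtain ⟨f₀, hf₀⟩ := hS.exists_minor_ne_zero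
  have : Nonempty (Fin n → Fin m) := ⟨f₀⟩
  -- Choosing a minor of maximal modulus bounds the chart: by Cramer's rule each entry of `A` is the
  -- ratio of a minor with one row replaced to this one.
  obtain ⟨f, hf⟩ := Finite.exists_max fun f : Fin n → Fin m => ‖(S.submatrix f id).det‖
  have hpos : 0 < ‖(S.submatrix f id).det‖ := (norm_pos_iff.mpr hf₀).trans_le (hf f₀)
  have hdet : (S.submatrix f id).det ≠ 0 := norm_pos_iff.mp hpos
  have hinj : Function.Injective f := by
    intro a b hab
    by_contra hne
    exact hdet (det_zero_of_row_eq hne (by ext j; simp [hab]))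
  set A := S * (S.submatrix f id)⁻¹ with hA
  have hAS : S = A * S.submatrix f id := by
    rw [hA, Matrix.mul_assoc, Matrix.nonsing_inv_mul _ hdet.isUnit, Matrix.mul_one]
  have hsub : ∀ g : Fin n → Fin m, S.submatrix g id = A.submatrix g id * S.submatrix f id := by
    intro g
    conv_lhs => rw [hAS]
    rfl
  have hA1 : A.submatrix f id = 1 := by
    rw [hA]
    exact Matrix.mul_nonsing_inv _ hdet.isUnit
  refine ⟨⟨f, hinj⟩, A, hAS, hdet.isUnit, hA1, fun i j => ?_⟩
  have h1 : A.submatrix (Function.update f j i) id = updateRow 1 j (A i) := by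
    ext a b
    by_cases hab : a = j
    · subst hab; simp
    · have := congrFun (congrFun hA1 a) b
      simpa [hab] using this
  have h2 : (A.submatrix (Function.update f j i) id).det = A i j := by
    rw [h1, ← cramer_transpose_apply, transpose_one, cramer_one]; rfl
  have h3 := hf (Function.update f j i)
  rw [hsub (Function.update f j i), det_mul, h2, norm_mul] at h3
  exact le_of_mul_le_mul_right (by simpa using h3) hpos

theorem abs_sub_le_of_floor_eq {m : ℕ} (hm : 0 < m) {x y : ℝ} (hx : |x| ≤ 1) (hy : |y| ≤ 1)
    (h : ⌊(x + 1) / 2 * m⌋₊ = ⌊(y + 1) / 2 * m⌋₊) : |x - y| ≤ 2 / m := by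
  have hm' : (0 : ℝ) < m := by exact_mod_cast hm
  rw [abs_le] at hx hy
  have hx0 : 0 ≤ (x + 1) / 2 * m := mul_nonneg (by linarith) hm'.le
  have hy0 : 0 ≤ (y + 1) / 2 * m := mul_nonneg (by linarith) hm'.le
  have hx1 := Nat.floor_le hx0
  have hx2 := Nat.lt_floor_add_one ((x + 1) / 2 * m)
  have hy1 := Nat.floor_le hy0
  have hy2 := Nat.lt_floor_add_one ((y + 1) / 2 * m)
  rw [h] at hx1 hx2
  have h1 : |(x - y) * m| ≤ 2 := abs_le.mpr ⟨by linarith, by linarith⟩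
  rwa [abs_mul, abs_of_pos hm', ← le_div_iff₀ hm'] at h1

-- There are `m + 1` cells rather than `m`, because the endpoint `x = 1` has floor exactly `m`.
theorem floor_lt_of_abs_le_one {m : ℕ} {x : ℝ} (hx : |x| ≤ 1) : ⌊(x + 1) / 2 * m⌋₊ < m + 1 := by
  rw [abs_le] at hx
  rw [Nat.floor_lt' (by omega)]
  push_cast
  nlinarith [hx.2, (Nat.cast_nonneg m : (0 : ℝ) ≤ m)]

/-- Grassmannian packings: too many subspaces cannot be far apart from each other. -/
theorem exists_chordalDist_le_of_card_lt {nt nr k m : ℕ} (hm : 0 < m)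
    {S : Fin k → Matrix (Fin nt) (Fin nr) ℂ} (hS : ∀ i, IsTruncatedUnitary (S i))
    (hk : Fintype.card (Fin nr ↪ Fin nt) * ((m + 1) * (m + 1)) ^ ((nt - nr) * nr) < k) :
    ∃ a b, a ≠ b ∧ chordalDist (S a) (S b) ≤
      2 * ((nt * nt + nt * nr * (nt * nr)) * (nr * nr) * (nt * nr)) * (nt * nr * 4) / m := by
  choose f A hAS hu hA1 hA using fun i => (hS i).exists_chart
  have hre : ∀ i p q, |(A i p q).re| ≤ 1 := fun i p q => (Complex.abs_re_le_norm _).trans (hA i p q)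
  have him : ∀ i p q, |(A i p q).im| ≤ 1 := fun i p q => (Complex.abs_im_le_norm _).trans (hA i p q)
  -- Pigeonhole on the chart and the grid cells of its coordinates. Rows in the range of the chart
  -- form the identity and are omitted, so the number of real coordinates is exactly the dimension
  -- `2 (nt - nr) nr`.
  let key : Fin k → Σ g : Fin nr ↪ Fin nt,
      ({r // r ∉ Set.range g} × Fin nr → Fin (m + 1) × Fin (m + 1)) := fun i =>
    ⟨f i, fun p => (⟨_, floor_lt_of_abs_le_one (hre i p.1 p.2)⟩,
      ⟨_, floor_lt_of_abs_le_one (him i p.1 p.2)⟩)⟩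
  have hcard : Fintype.card (Σ g : Fin nr ↪ Fin nt,
      ({r // r ∉ Set.range g} × Fin nr → Fin (m + 1) × Fin (m + 1))) < Fintype.card (Fin k) := by
    rw [Fintype.card_sigma, Fintype.card_fin]
    refine lt_of_eq_of_lt ?_ hk
    have : ∀ g : Fin nr ↪ Fin nt, Fintype.card {r // r ∉ Set.range g} = nt - nr := fun g => by
      rw [Fintype.card_subtype_compl, Fintype.card_fin]
      congr 1
      have := Set.card_range_of_injective g.injective
      rwa [Fintype.card_fin] at this
    simp [this, -Set.mem_range]
  obtain ⟨a, b, hab, hkey⟩ := Fintype.exists_ne_map_eq_of_card_lt key hcard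
  refine ⟨a, b, hab, ?_⟩
  have hf : f a = f b := congrArg Sigma.fst hkey
  have hent : ∀ p q, ‖(A a - A b) p q‖ ≤ 4 / m := by
    intro p q
    by_cases hp : p ∈ Set.range (f a)
    · obtain ⟨c, rfl⟩ := hp
      have h1 := congrFun (congrFun (hA1 a) c) q
      have h2 := congrFun (congrFun (hA1 b) c) q
      simp only [submatrix_apply, id] at h1 h2
      rw [← hf] at h2
      rw [Matrix.sub_apply, h1, h2, sub_self, norm_zero]
      positivity
    -- The type of the cell data depends on the chart, so equal keys are compared after generalizing
    -- them to variables.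
    · have hcell : ∀ (x y : Σ g : Fin nr ↪ Fin nt,
          ({r // r ∉ Set.range g} × Fin nr → Fin (m + 1) × Fin (m + 1))) (_ : x = y)
          (h1 : p ∉ Set.range x.1) (h2 : p ∉ Set.range y.1), x.2 (⟨p, h1⟩, q) = y.2 (⟨p, h2⟩, q) := by
        rintro x _ rfl _ _; rfl
      have h1 := hcell _ _ hkey hp (by change p ∉ Set.range (f b); rwa [← hf])
      have h2 := congrArg (fun z => (z.1 : ℕ)) h1
      have h3 := congrArg (fun z => (z.2 : ℕ)) h1
      have h4 := abs_sub_le_of_floor_eq hm (hre a p q) (hre b p q) h2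
      have h5 := abs_sub_le_of_floor_eq hm (him a p q) (him b p q) h3
      calc ‖(A a - A b) p q‖ ≤ _ := Complex.norm_le_abs_re_add_abs_im _
        _ ≤ 2 / m + 2 / m := add_le_add (by simpa using h4) (by simpa using h5)
        _ = 4 / m := by ring
  have hsub : ∀ i p q, ‖((S i).submatrix (f i) id) p q‖ ≤ 1 := fun i p q => (hS i).entry_le_one _ _
  refine (chordalDist_le_of_charts (hS a) (hS b) (hAS a) (hAS b) (hsub a) (hsub b) (hu a)
    (hu b)).trans ?_
  rw [mul_div_assoc]
  gcongr
  exact (norm_le_of_entry_le (by positivity) hent).trans (by rw [mul_div_assoc])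

/-- The quantization error of a saturated packing of the Grassmann manifold decays like the inverse
of its cardinality to the power of the inverse of the real dimension of the manifold. -/
theorem exists_chordalDist_quantization_le {nt nr : ℕ} (hrt : nr < nt) (hr : 0 < nr) :
    ∃ C : ℝ, 0 < C ∧ ∀ᶠ t : ℝ in atTop, ∀ (k : ℕ) (S : Fin k → Matrix (Fin nt) (Fin nr) ℂ),
      IsSpherePackingCodebook S → t ^ (2 * ((nt - nr) * nr)) / 2 ≤ k →
      ∀ X Xh, IsTruncatedUnitary X → IsQuantization S X Xh → chordalDist Xh X ≤ C / t := by
  set c := Fintype.card (Fin nr ↪ Fin nt) with hc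
  set N := (nt - nr) * nr with hN
  have hN1 : 2 * N ≠ 0 := by
    have := Nat.mul_pos (Nat.sub_pos_of_lt hrt) hr
    omega
  set D : ℝ := 2 * ((nt * nt + nt * nr * (nt * nr)) * (nr * nr) * (nt * nr)) * (nt * nr * 4) with hD
  have hD0 : 0 < D := by
    have h1 : (0 : ℝ) < nt := by exact_mod_cast (hr.trans hrt)
    have h2 : (0 : ℝ) < nr := by exact_mod_cast hr
    positivity
  -- For `m ≈ t / q`, the number of cells over all `c` charts is at most `c (2t/q)^(2N) ≤ c (2/q)
  -- t^(2N)`, and `4c < q` brings this below `t^(2N) / 2`.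
  set q : ℝ := 4 * c + 4 with hq
  have hq0 : 0 < q := by positivity
  refine ⟨D * (2 * q), by positivity, ?_⟩
  filter_upwards [eventually_ge_atTop (2 * q)] with t ht k S hS hk X Xh hX hXh
  have ht0 : 0 < t := by linarith
  set m := ⌊t / q⌋₊ with hm
  have htq : 2 ≤ t / q := by rwa [le_div_iff₀ hq0]
  have hm1 : t / q < m + 1 := Nat.lt_floor_add_one _
  have hm2 : (m : ℝ) ≤ t / q := Nat.floor_le (by positivity)
  have hm3 : t / (2 * q) ≤ m := by
    have : t / (2 * q) = t / q / 2 := by rw [div_div, mul_comm]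
    rw [this]; linarith
  have hm0 : 0 < m := by
    have : (0 : ℝ) < m := lt_of_lt_of_le (by positivity) hm3
    exact_mod_cast this
  have hcard : c * ((m + 1) * (m + 1)) ^ N < k := by
    have h1 : ((c * ((m + 1) * (m + 1)) ^ N : ℕ) : ℝ) < k := by
      push_cast
      rw [← pow_two, ← pow_mul]
      have h2 : ((m : ℝ) + 1) ^ (2 * N) ≤ (t * (2 / q)) ^ (2 * N) := by
        refine pow_le_pow_left₀ (by positivity) ?_ _
        have : t * (2 / q) = t / q + t / q := by ring
        rw [this]; linarith
      have h3 : (2 / q) ^ (2 * N) ≤ 2 / q :=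
        pow_le_of_le_one (by positivity) (by
          rw [div_le_one hq0, hq]
          linarith [(Nat.cast_nonneg c : (0 : ℝ) ≤ c)]) hN1
      have h4 : c * (2 / q) < 1 / 2 := by
        rw [mul_div_assoc', div_lt_iff₀ hq0, hq]; linarith
      calc c * ((m : ℝ) + 1) ^ (2 * N) ≤ c * (t ^ (2 * N) * (2 / q)) := by
            rw [mul_pow] at h2
            gcongr
            exact h2.trans (by gcongr)
        _ = t ^ (2 * N) * (c * (2 / q)) := by ring
        _ < t ^ (2 * N) * (1 / 2) := by gcongr
        _ = t ^ (2 * N) / 2 := by ring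
        _ ≤ k := hk
    exact_mod_cast h1
  obtain ⟨a, b, hab, hdist⟩ := exists_chordalDist_le_of_card_lt hm0 hS.truncatedUnitary hcard
  obtain ⟨i, hi⟩ := hS.saturated X hX
  obtain ⟨j, rfl, hj⟩ := hXh
  -- The nearest codeword is no farther than the codeword given by saturation, which is no farther
  -- than the close pair `a`, `b` are from each other.
  refine (hj i).trans ((hi a b hab).trans (hdist.trans ?_))
  rw [← hD, div_le_div_iff₀ (by exact_mod_cast hm0) ht0]
  rw [div_le_iff₀ (by positivity)] at hm3
  nlinarith

/-- The packing bound at `t = P^((1+ε)/2)`. The one-bit rounding error costs a factor 2 in the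
number of codewords, which the packing bound allows for. -/
theorem FeedbackScaling.exists_chordalDist_le {nt nr : ℕ} (hrt : nr < nt) (hr : 0 < nr) {ε : ℝ}
    (hε : 0 ≤ ε) {Nf : ℝ → ℕ} (hNf : FeedbackScaling nt nr ε Nf)
    {S : (P : ℝ) → Fin (2 ^ Nf P) → Matrix (Fin nt) (Fin nr) ℂ}
    (hS : ∀ P, IsSpherePackingCodebook (S P)) :
    ∃ C : ℝ, 0 < C ∧ ∀ᶠ P : ℝ in atTop, ∀ X Xh, IsTruncatedUnitary X → IsQuantization (S P) X Xh →
      chordalDist Xh X ≤ C / P ^ ((1 + ε) / 2) := by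
  obtain ⟨C, hC, h⟩ := exists_chordalDist_quantization_le hrt hr
  refine ⟨C, hC, ?_⟩
  filter_upwards [(tendsto_rpow_atTop (show 0 < (1 + ε) / 2 by linarith)).eventually h, hNf,
    eventually_gt_atTop 0] with P hP hN hP0 X Xh hX hXh
  refine hP _ _ (hS P) ?_ X Xh hX hXh
  rw [abs_le] at hN
  have h1 : (1 + ε) * ((2 * nr * ((nt : ℝ) - nr)) / 2) * Real.logb 2 P - 1 ≤ Nf P := by linarith
  have h2 := Real.rpow_le_rpow_of_exponent_le (one_le_two (α := ℝ)) h1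
  rw [Real.rpow_natCast, Real.rpow_sub two_pos, Real.rpow_one, mul_comm _ (Real.logb 2 P),
    Real.rpow_mul two_pos.le, Real.rpow_logb two_pos (by norm_num) hP0] at h2
  push_cast
  refine le_trans (le_of_eq ?_) h2
  rw [← Real.rpow_natCast, ← Real.rpow_mul hP0.le]
  congr 2
  push_cast [Nat.cast_sub hrt.le]
  ring

theorem entry_le_chordalDist {m n : ℕ} (S F : Matrix (Fin m) (Fin n) ℂ) (i j : Fin m) :
    ‖(S * Sᴴ - F * Fᴴ) i j‖ ≤ 2 * chordalDist S F := by
  refine (entry_le_norm _ i j).trans ?_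
  rw [chordalDist, frobNorm_eq_norm, ← mul_assoc]
  refine le_mul_of_one_le_left (norm_nonneg _) ?_
  rw [mul_one_div, one_le_div (by positivity)]
  exact Real.sqrt_le_iff.mpr ⟨by norm_num, by norm_num⟩

end Quantization

/-! ### Matrix limits, positivity and complementary projections -/

section MatrixLimits

variable {α : Type*} {l : Filter α} {m n p : ℕ}

theorem tendsto_matrix_mul {A : α → Matrix (Fin m) (Fin n) ℂ} {B : α → Matrix (Fin n) (Fin p) ℂ}
    {A₀ : Matrix (Fin m) (Fin n) ℂ} {B₀ : Matrix (Fin n) (Fin p) ℂ} (hA : Tendsto A l (𝓝 A₀))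
    (hB : Tendsto B l (𝓝 B₀)) : Tendsto (fun x => A x * B x) l (𝓝 (A₀ * B₀)) := by
  refine tendsto_pi_nhds.mpr fun i => tendsto_pi_nhds.mpr fun j => ?_
  simp only [Matrix.mul_apply]
  exact tendsto_finsetSum _ fun k _ => ((hA.apply_nhds i).apply_nhds k).mul
    ((hB.apply_nhds k).apply_nhds j)

theorem tendsto_matrix_conjTranspose {A : α → Matrix (Fin m) (Fin n) ℂ}
    {A₀ : Matrix (Fin m) (Fin n) ℂ} (hA : Tendsto A l (𝓝 A₀)) :
    Tendsto (fun x => (A x)ᴴ) l (𝓝 A₀ᴴ) :=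
  (continuous_id.matrix_conjTranspose.tendsto A₀).comp hA

theorem tendsto_matrix_det_re {A : α → Matrix (Fin n) (Fin n) ℂ}
    {A₀ : Matrix (Fin n) (Fin n) ℂ} (hA : Tendsto A l (𝓝 A₀)) :
    Tendsto (fun x => (A x).det.re) l (𝓝 A₀.det.re) :=
  ((Complex.continuous_re.comp continuous_id.matrix_det).tendsto A₀).comp hA

theorem posSemidef_of_tendsto [l.NeBot] {A : α → Matrix (Fin n) (Fin n) ℂ}
    {A₀ : Matrix (Fin n) (Fin n) ℂ} (hA : Tendsto A l (𝓝 A₀)) (h : ∀ᶠ x in l, (A x).PosSemidef) :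
    A₀.PosSemidef := by
  have := Complex.orderClosedTopology
  refine PosSemidef.of_dotProduct_mulVec_nonneg
    (tendsto_nhds_unique_of_eventuallyEq (tendsto_matrix_conjTranspose hA) hA
      (h.mono fun x hx => hx.1)) fun x => ?_
  have hc : Continuous fun M : Matrix (Fin n) (Fin n) ℂ => star x ⬝ᵥ (M *ᵥ x) := by fun_prop
  exact ge_of_tendsto ((hc.tendsto A₀).comp hA) (h.mono fun y hy => hy.dotProduct_mulVec_nonneg x)

/-- Bolzano–Weierstrass for ultrafilters: several bounded families converge along the same `U`,
without extracting successive subsequences. -/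
theorem exists_tendsto_of_entry_le {U : Ultrafilter α} {A : α → Matrix (Fin m) (Fin n) ℂ} {r : ℝ}
    (h : ∀ᶠ x in (U : Filter α), ∀ i j, ‖A x i j‖ ≤ r) :
    ∃ A₀, Tendsto A U (𝓝 A₀) := by
  have hc : IsCompact (Metric.closedBall (0 : ℂ) r).matrix :=
    (isCompact_closedBall (0 : ℂ) r).matrix (m := Fin m) (n := Fin n)
  obtain ⟨A₀, -, hA₀⟩ := hc.ultrafilter_le_nhds (U.map A) (by
    rw [Ultrafilter.coe_map, le_principal_iff, mem_map]
    filter_upwards [h] with x hx i j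
    simpa using hx i j)
  exact ⟨A₀, hA₀⟩

/-- Diagonal entries lie in `[0, r]`, and nonnegative 2 × 2 principal minors give `‖A i j‖² ≤ A i i
* A j j`. -/
theorem entry_le_of_posSemidef {A : Matrix (Fin n) (Fin n) ℂ} {r : ℝ} (hA : A.PosSemidef)
    (hr : ((r : ℂ) • (1 : Matrix (Fin n) (Fin n) ℂ) - A).PosSemidef) (i j : Fin n) :
    ‖A i j‖ ≤ r := by
  have hdiag : ∀ k, 0 ≤ (A k k).re ∧ (A k k).re ≤ r ∧ (A k k).im = 0 := by
    intro k
    have h1 := Complex.le_def.mp (hA.diag_nonneg (i := k))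
    have h2 := Complex.le_def.mp (hr.diag_nonneg (i := k))
    simp at h1 h2
    exact ⟨h1.1, h2.1, h1.2.symm⟩
  have hr0 : 0 ≤ r := (hdiag i).1.trans (hdiag i).2.1
  have h1 := (hA.submatrix ![i, j]).det_nonneg
  rw [det_fin_two] at h1
  have h2 : A j i = star (A i j) := (hA.1.apply j i).symm
  have h3 := (Complex.le_def.mp h1).1
  simp only [submatrix_apply, Matrix.cons_val_zero, Matrix.cons_val_one, h2] at h3
  have h4 : (A i j * star (A i j)).re = ‖A i j‖ ^ 2 := by
    have := Complex.mul_conj' (A i j)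
    rw [show star (A i j) = (starRingEnd ℂ) (A i j) from rfl, this]
    exact_mod_cast Complex.ofReal_re _
  rw [Complex.sub_re, h4, Complex.mul_re, (hdiag i).2.2, zero_mul, sub_zero, Complex.zero_re] at h3
  refine abs_le_of_sq_le_sq' ?_ hr0 |>.2
  nlinarith [hdiag i, hdiag j, mul_le_mul (hdiag i).2.1 (hdiag j).2.1 (hdiag j).1 hr0]

theorem posDef_mul_mul_conjTranspose {A : Matrix (Fin m) (Fin n) ℂ} {R : Matrix (Fin n) (Fin m) ℂ}
    {K : Matrix (Fin n) (Fin n) ℂ} (hK : K.PosDef) (hR : A * R = 1) : (A * K * Aᴴ).PosDef := by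
  refine hK.mul_mul_conjTranspose_same fun x y hxy => ?_
  have := congrArg (fun z => z ᵥ* R) hxy
  simpa [vecMul_vecMul, hR] using this

theorem posDef_mul_conjTranspose {A : Matrix (Fin m) (Fin n) ℂ} {R : Matrix (Fin n) (Fin m) ℂ}
    (hR : A * R = 1) : (A * Aᴴ).PosDef := by
  simpa using posDef_mul_mul_conjTranspose PosDef.one hR

theorem posDef_ofReal_smul {A : Matrix (Fin n) (Fin n) ℂ} (hA : A.PosDef) {a : ℝ} (ha : 0 < a) :
    ((a : ℂ) • A).PosDef :=
  hA.smul (show (0 : ℂ) < (a : ℂ) by exact_mod_cast ha)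

theorem posSemidef_ofReal_smul {A : Matrix (Fin n) (Fin n) ℂ} (hA : A.PosSemidef) {a : ℝ}
    (ha : 0 ≤ a) : ((a : ℂ) • A).PosSemidef :=
  hA.smul (show (0 : ℂ) ≤ (a : ℂ) by exact_mod_cast ha)

theorem det_re_pos {A : Matrix (Fin n) (Fin n) ℂ} (hA : A.PosDef) : 0 < A.det.re :=
  (Complex.lt_def.mp hA.det_pos).1

theorem det_ofReal_smul_re (A : Matrix (Fin n) (Fin n) ℂ) (x : ℝ) :
    ((x : ℂ) • A).det.re = x ^ n * A.det.re := by
  rw [det_smul, Fintype.card_fin, ← Complex.ofReal_pow, Complex.re_ofReal_mul]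

/-- Complementary truncated unitary matrices have complementary projections. -/
theorem IsTruncatedUnitary.add_compl {nt nr : ℕ} (hrt : nr < nt) {S : Matrix (Fin nt) (Fin nr) ℂ}
    {T : Matrix (Fin nt) (Fin (nt - nr)) ℂ} (hS : IsTruncatedUnitary S)
    (hT : IsTruncatedUnitary T) (hST : Sᴴ * T = 0) : T * Tᴴ = 1 - S * Sᴴ := by
  have hTS : Tᴴ * S = 0 := by
    have := congrArg conjTranspose hST
    simpa using this
  let e : Fin nr ⊕ Fin (nt - nr) ≃ Fin nt := Fintype.equivOfCardEq (by simp; omega)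
  have h1 : (fromRows Sᴴ Tᴴ) * (fromCols S T) = 1 := by
    rw [fromRows_mul_fromCols, hS, hT, hST, hTS, fromBlocks_one]
  -- The square matrix `[S | T]` has a left inverse, so the reversed product `S Sᴴ + T Tᴴ` is also
  -- the identity.
  rw [Matrix.mul_eq_one_comm_of_equiv e, fromCols_mul_fromRows] at h1
  rw [← h1, add_sub_cancel_left]

end MatrixLimits

/-! ### High-power expansion of the rates -/

section RateLimits

variable {nt nr ne ds : ℕ}

/-- The constant term of the high-power expansion of a secrecy rate: `M` is the limit of the
normalized signal covariance at the transmitter, `Q` that of the normalized artificial noise at the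
eavesdropper and `E` that of the artificial noise leaking to the receiver. -/
noncomputable def rateLimit (ρ σ : ℝ) (nr : ℕ) (Z : Matrix (Fin ds) (Fin nt) ℂ) (He : Matrix (Fin ne) (Fin nt) ℂ)
    (G : Matrix (Fin ds) (Fin ds) ℂ) (M : Matrix (Fin nt) (Fin nt) ℂ)
    (Q : Matrix (Fin ne) (Fin ne) ℂ) (E : Matrix (Fin ds) (Fin ds) ℂ) : ℝ :=
  Real.logb 2 (((ρ : ℂ) • (Z * M * Zᴴ)).det.re /
      ((noisePower nt nr ρ 1 : ℂ) • E + ((σ ^ 2 : ℝ) : ℂ) • (Gᴴ * G)).det.re)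
    - Real.logb 2 (((ρ : ℂ) • (He * M * Heᴴ) + (noisePower nt nr ρ 1 : ℂ) • Q).det.re /
      ((noisePower nt nr ρ 1 : ℂ) • Q).det.re)

theorem noisePower_eq_mul (ρ P : ℝ) : noisePower nt nr ρ P = P * noisePower nt nr ρ 1 := by
  simp only [noisePower]; ring

theorem noisePower_one_pos (hrt : nr < nt) {ρ : ℝ} (hρ : ρ < 1) : 0 < noisePower nt nr ρ 1 := by
  have : (nr : ℝ) < nt := by exact_mod_cast hrt
  exact div_pos (by linarith) (by linarith)

theorem signalCov_eq_smul {n : ℕ} (ρ : ℝ) {P : ℝ} (hP : P ≠ 0) (K : Matrix (Fin nr) (Fin nr) ℂ)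
    (H : Matrix (Fin n) (Fin nt) ℂ) (W : Matrix (Fin nt) (Fin nr) ℂ) :
    signalCov ρ K H W =
      (P : ℂ) • ((ρ : ℂ) • (H * (W * (((P⁻¹ : ℝ) : ℂ) • K) * Wᴴ) * Hᴴ)) := by
  have hP' : (P : ℂ) ≠ 0 := by exact_mod_cast hP
  simp only [signalCov, Matrix.mul_smul, Matrix.smul_mul, smul_smul, Matrix.mul_assoc]
  congr 1
  push_cast
  field_simp

theorem artificialNoiseCov_eq_smul {n : ℕ} (ρ P : ℝ)
    (H : Matrix (Fin n) (Fin nt) ℂ) (W : Matrix (Fin nt) (Fin (nt - nr)) ℂ) :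
    artificialNoiseCov nr ρ P H W =
      (P : ℂ) • ((noisePower nt nr ρ 1 : ℂ) • (H * (W * Wᴴ) * Hᴴ)) := by
  rw [artificialNoiseCov, noisePower_eq_mul, smul_smul, Complex.ofReal_mul]
  simp only [Matrix.mul_assoc]

theorem tendsto_ofReal_inv {U : Filter ℝ} (hU : U ≤ atTop) :
    Tendsto (fun P : ℝ => ((P⁻¹ : ℝ) : ℂ)) U (𝓝 0) := by
  have h := (Complex.continuous_ofReal.tendsto 0).comp (tendsto_inv_atTop_zero.mono_left hU)
  rwa [Complex.ofReal_zero] at h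

/-- Signal and artificial noise both grow like `P`, so the factor `P^ne` cancels in the ratio of
determinants and the thermal noise disappears. Definiteness of `He Q Heᴴ` keeps the limiting
denominator positive. -/
theorem tendsto_eveRate {U : Filter ℝ} (hU : U ≤ atTop) (hrt : nr < nt) {ρ σe : ℝ} (hρ0 : 0 < ρ)
    (hρ1 : ρ < 1) {K : ℝ → Matrix (Fin nr) (Fin nr) ℂ} {He : Matrix (Fin ne) (Fin nt) ℂ}
    {W : ℝ → Matrix (Fin nt) (Fin nr) ℂ} {W' : ℝ → Matrix (Fin nt) (Fin (nt - nr)) ℂ}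
    {K₀ : Matrix (Fin nr) (Fin nr) ℂ} {W₀ : Matrix (Fin nt) (Fin nr) ℂ}
    {Q : Matrix (Fin nt) (Fin nt) ℂ}
    (hK : Tendsto (fun P : ℝ => ((P⁻¹ : ℝ) : ℂ) • K P) U (𝓝 K₀)) (hW : Tendsto W U (𝓝 W₀))
    (hQ : Tendsto (fun P => W' P * (W' P)ᴴ) U (𝓝 Q)) (hK₀ : K₀.PosSemidef)
    (hQ₀ : (He * Q * Heᴴ).PosDef) :
    Tendsto (fun P => eveRate ρ σe P (K P) He (W P) (W' P)) U
      (𝓝 (Real.logb 2 (((ρ : ℂ) • (He * (W₀ * K₀ * W₀ᴴ) * Heᴴ)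
          + (noisePower nt nr ρ 1 : ℂ) • (He * Q * Heᴴ)).det.re /
        ((noisePower nt nr ρ 1 : ℂ) • (He * Q * Heᴴ)).det.re))) := by
  set a := noisePower nt nr ρ 1 with ha
  have ha0 : 0 < a := noisePower_one_pos hrt hρ1
  have hden : ((a : ℂ) • (He * Q * Heᴴ)).PosDef := posDef_ofReal_smul hQ₀ ha0
  have hsig : ((ρ : ℂ) • (He * (W₀ * K₀ * W₀ᴴ) * Heᴴ)).PosSemidef :=
    posSemidef_ofReal_smul ((hK₀.mul_mul_conjTranspose_same W₀).mul_mul_conjTranspose_same He) hρ0.le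
  have hnum : ((ρ : ℂ) • (He * (W₀ * K₀ * W₀ᴴ) * Heᴴ) + (a : ℂ) • (He * Q * Heᴴ)).PosDef :=
    PosDef.posSemidef_add hsig hden
  have hnoise : Tendsto (fun P => (a : ℂ) • (He * (W' P * (W' P)ᴴ) * Heᴴ)
      + ((P⁻¹ : ℝ) : ℂ) • (((σe ^ 2 : ℝ) : ℂ) • (1 : Matrix (Fin ne) (Fin ne) ℂ))) U
      (𝓝 ((a : ℂ) • (He * Q * Heᴴ))) := by
    have h1 := ((tendsto_matrix_mul (tendsto_matrix_mul (tendsto_const_nhds (x := He)) hQ)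
      (tendsto_const_nhds (x := Heᴴ))).const_smul (a : ℂ)).add
      ((tendsto_ofReal_inv hU).smul_const (((σe ^ 2 : ℝ) : ℂ) • (1 : Matrix (Fin ne) (Fin ne) ℂ)))
    simpa using h1
  have hsignal : Tendsto (fun P => (ρ : ℂ) •
      (He * (W P * (((P⁻¹ : ℝ) : ℂ) • K P) * (W P)ᴴ) * Heᴴ)) U
      (𝓝 ((ρ : ℂ) • (He * (W₀ * K₀ * W₀ᴴ) * Heᴴ))) :=
    (tendsto_matrix_mul (tendsto_matrix_mul tendsto_const_nhds (tendsto_matrix_mul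
      (tendsto_matrix_mul hW hK) (tendsto_matrix_conjTranspose hW))) tendsto_const_nhds).const_smul _
  have hlim := (((tendsto_matrix_det_re (hsignal.add hnoise)).div (tendsto_matrix_det_re hnoise)
    (det_re_pos hden).ne').logb (b := 2) (div_pos (det_re_pos hnum) (det_re_pos hden)).ne')
  refine hlim.congr' ?_
  filter_upwards [hU (eventually_gt_atTop (0 : ℝ))] with P hP
  have hP' : (P : ℂ) ≠ 0 := by exact_mod_cast hP.ne'
  have h1 : artificialNoiseCov nr ρ P He (W' P)
      + ((σe ^ 2 : ℝ) : ℂ) • (1 : Matrix (Fin ne) (Fin ne) ℂ) =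
      (P : ℂ) • ((a : ℂ) • (He * (W' P * (W' P)ᴴ) * Heᴴ)
      + ((P⁻¹ : ℝ) : ℂ) • (((σe ^ 2 : ℝ) : ℂ) • (1 : Matrix (Fin ne) (Fin ne) ℂ))) := by
    rw [artificialNoiseCov_eq_smul, smul_add, smul_smul (P : ℂ) ((P⁻¹ : ℝ) : ℂ), Complex.ofReal_inv,
      mul_inv_cancel₀ hP', one_smul]
  rw [eveRate, add_assoc, h1, signalCov_eq_smul ρ hP.ne', ← smul_add, det_ofReal_smul_re,
    det_ofReal_smul_re, mul_div_mul_left _ _ (by positivity)]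
  rfl

/-- High-power expansion of a secrecy rate along a filter. -/
theorem tendsto_rateQuantized_sub {U : Filter ℝ} (hU : U ≤ atTop) (hrt : nr < nt) {ρ σ σe : ℝ}
    (hρ0 : 0 < ρ) (hρ1 : ρ < 1) (hσ : 0 < σ) {K : ℝ → Matrix (Fin nr) (Fin nr) ℂ}
    {Hd : Matrix (Fin nr) (Fin nt) ℂ} {He : Matrix (Fin ne) (Fin nt) ℂ}
    {V : Matrix (Fin nr) (Fin ds) ℂ} {G : Matrix (Fin ds) (Fin ds) ℂ}
    {W : ℝ → Matrix (Fin nt) (Fin nr) ℂ} {W' : ℝ → Matrix (Fin nt) (Fin (nt - nr)) ℂ}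
    {K₀ : Matrix (Fin nr) (Fin nr) ℂ} {W₀ : Matrix (Fin nt) (Fin nr) ℂ}
    {Q : Matrix (Fin nt) (Fin nt) ℂ} {E : Matrix (Fin ds) (Fin ds) ℂ}
    (hK : Tendsto (fun P : ℝ => ((P⁻¹ : ℝ) : ℂ) • K P) U (𝓝 K₀)) (hW : Tendsto W U (𝓝 W₀))
    (hQ : Tendsto (fun P => W' P * (W' P)ᴴ) U (𝓝 Q)) (hK₀ : K₀.PosSemidef)
    (hQ₀ : (He * Q * Heᴴ).PosDef)
    (hE : Tendsto (fun P : ℝ => (P : ℂ) •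
      ((Gᴴ * Vᴴ * Hd) * (W' P * (W' P)ᴴ) * (Gᴴ * Vᴴ * Hd)ᴴ)) U (𝓝 E))
    (hE₀ : E.PosSemidef) (hG : (Gᴴ * G).PosDef)
    (hZ : ((Gᴴ * Vᴴ * Hd) * (W₀ * K₀ * W₀ᴴ) * (Gᴴ * Vᴴ * Hd)ᴴ).PosDef) :
    Tendsto (fun P => rateQuantized ρ σ σe P (K P) Hd He V G (W P) (W' P) - ds * Real.logb 2 P) U
      (𝓝 (rateLimit ρ σ nr (Gᴴ * Vᴴ * Hd) He G (W₀ * K₀ * W₀ᴴ) (He * Q * Heᴴ) E)) := by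
  set Z := Gᴴ * Vᴴ * Hd with hZdef
  set a := noisePower nt nr ρ 1 with ha
  have ha0 : 0 < a := noisePower_one_pos hrt hρ1
  have hden : ((a : ℂ) • E + ((σ ^ 2 : ℝ) : ℂ) • (Gᴴ * G)).PosDef :=
    PosDef.posSemidef_add (posSemidef_ofReal_smul hE₀ ha0.le)
      (posDef_ofReal_smul hG (by positivity))
  have hnum : ((ρ : ℂ) • (Z * (W₀ * K₀ * W₀ᴴ) * Zᴴ)).PosDef := posDef_ofReal_smul hZ hρ0
  have hnoise : Tendsto (fun P : ℝ => (a : ℂ) • ((P : ℂ) • (Z * (W' P * (W' P)ᴴ) * Zᴴ))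
      + ((σ ^ 2 : ℝ) : ℂ) • (Gᴴ * G)) U (𝓝 ((a : ℂ) • E + ((σ ^ 2 : ℝ) : ℂ) • (Gᴴ * G))) :=
    (hE.const_smul _).add_const _
  have hsignal : Tendsto (fun P => (ρ : ℂ) •
      (Z * (W P * (((P⁻¹ : ℝ) : ℂ) • K P) * (W P)ᴴ) * Zᴴ)) U
      (𝓝 ((ρ : ℂ) • (Z * (W₀ * K₀ * W₀ᴴ) * Zᴴ))) :=
    (tendsto_matrix_mul (tendsto_matrix_mul tendsto_const_nhds (tendsto_matrix_mul
      (tendsto_matrix_mul hW hK) (tendsto_matrix_conjTranspose hW))) tendsto_const_nhds).const_smul _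
  -- At the receiver only the numerator is divided by `P`, because the leaked noise stays bounded.
  -- The factor `P^ds` pulled out of it is the source of the term `ds * logb 2 P`.
  have hsum := hsignal.add ((tendsto_ofReal_inv hU).smul hnoise)
  rw [zero_smul, add_zero] at hsum
  have hdet := tendsto_matrix_det_re hsum
  have hdet' := tendsto_matrix_det_re hnoise
  have hlim := (hdet.div hdet' (det_re_pos hden).ne').logb (b := 2)
    (div_pos (det_re_pos hnum) (det_re_pos hden)).ne'
  refine (hlim.sub (tendsto_eveRate (σe := σe) hU hrt hρ0 hρ1 hK hW hQ hK₀ hQ₀)).congr' ?_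
  filter_upwards [hU (eventually_gt_atTop (0 : ℝ)),
    hdet.eventually_const_lt (det_re_pos hnum), hdet'.eventually_const_lt (det_re_pos hden)]
    with P hP hn hd
  have hP' : (P : ℂ) ≠ 0 := by exact_mod_cast hP.ne'
  have h1 : artificialNoiseCov nr ρ P Z (W' P) + ((σ ^ 2 : ℝ) : ℂ) • (Gᴴ * G) =
      (a : ℂ) • ((P : ℂ) • (Z * (W' P * (W' P)ᴴ) * Zᴴ)) + ((σ ^ 2 : ℝ) : ℂ) • (Gᴴ * G) := by
    rw [artificialNoiseCov_eq_smul, smul_comm]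
  have h2 : signalCov ρ (K P) Z (W P) + artificialNoiseCov nr ρ P Z (W' P)
      + ((σ ^ 2 : ℝ) : ℂ) • (Gᴴ * G) =
      (P : ℂ) • ((ρ : ℂ) • (Z * (W P * (((P⁻¹ : ℝ) : ℂ) • K P) * (W P)ᴴ) * Zᴴ)
        + ((P⁻¹ : ℝ) : ℂ) • ((a : ℂ) • ((P : ℂ) • (Z * (W' P * (W' P)ᴴ) * Zᴴ))
          + ((σ ^ 2 : ℝ) : ℂ) • (Gᴴ * G))) := by
    rw [add_assoc, h1, signalCov_eq_smul ρ hP.ne', smul_add, smul_smul (P : ℂ) ((P⁻¹ : ℝ) : ℂ),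
      Complex.ofReal_inv, mul_inv_cancel₀ hP', one_smul]
  rw [rateQuantized, ← hZdef, h2, h1, det_ofReal_smul_re, mul_div_assoc,
    Real.logb_mul (by positivity) (div_pos hn hd).ne', Real.logb_pow]
  simp only [Pi.div_apply]
  ring

/-- Perfect CSI is the case of zero leakage, so one expansion serves both rates. -/
theorem ratePerfect_eq_rateQuantized {ρ σ σe P : ℝ} {K : Matrix (Fin nr) (Fin nr) ℂ}
    {Hd : Matrix (Fin nr) (Fin nt) ℂ} {He : Matrix (Fin ne) (Fin nt) ℂ}
    {V : Matrix (Fin nr) (Fin ds) ℂ} {G : Matrix (Fin ds) (Fin ds) ℂ}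
    {W1 : Matrix (Fin nt) (Fin nr) ℂ} {W2 : Matrix (Fin nt) (Fin (nt - nr)) ℂ}
    (h : Hd * W2 = 0) :
    ratePerfect ρ σ σe P K Hd He V G W1 W2 = rateQuantized ρ σ σe P K Hd He V G W1 W2 := by
  have h1 : artificialNoiseCov nr ρ P (Gᴴ * Vᴴ * Hd) W2 = 0 := by
    rw [artificialNoiseCov, Matrix.mul_assoc (Gᴴ * Vᴴ) Hd, h]
    simp
  rw [ratePerfect, rateQuantized, h1, add_zero, zero_add]

/-- The limit `r` may depend on the ultrafilter, since it disappears after division by `logb 2 P`.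
-/
theorem HasSDoF.of_ultrafilter {R : ℝ → ℝ} {d : ℝ}
    (h : ∀ U : Ultrafilter ℝ, (U : Filter ℝ) ≤ atTop →
      ∃ r, Tendsto (fun P => R P - d * Real.logb 2 P) U (𝓝 r)) : HasSDoF R d := by
  refine (tendsto_iff_ultrafilter _ _ _).mpr fun U hU => ?_
  obtain ⟨r, hr⟩ := h U hU
  have hlog : Tendsto (Real.logb 2) U atTop := (Real.tendsto_logb_atTop one_lt_two).mono_left hU
  have h1 := (hr.div_atTop hlog).add_const d
  rw [zero_add] at h1
  refine h1.congr' ?_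
  filter_upwards [hlog.eventually_gt_atTop 0] with P hP
  field_simp
  ring

end RateLimits

/-! ### Limits of the transmission scheme -/

section Scheme

variable {nt nr nj ne : ℕ} {Nf : ℝ → ℕ} {Hd : Matrix (Fin nr) (Fin nt) ℂ}
  {Hj : Matrix (Fin nr) (Fin nj) ℂ} {He : Matrix (Fin ne) (Fin nt) ℂ}
  {S : (P : ℝ) → Fin (2 ^ Nf P) → Matrix (Fin nt) (Fin nr) ℂ}
  {V : Matrix (Fin nr) (Fin (nr - nj)) ℂ}
  {F : Matrix (Fin nt) (Fin nr) ℂ} {C : Matrix (Fin nr) (Fin nr) ℂ}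
  {Fhat W1 : ℝ → Matrix (Fin nt) (Fin nr) ℂ} {W2 W2Q : ℝ → Matrix (Fin nt) (Fin (nt - nr)) ℂ}

theorem IsScheme.channel_eq (h : IsScheme Hd Hj S V F C Fhat W1 W2 W2Q) : Hd = Cᴴ * Fᴴ := by
  rw [← conjTranspose_mul, ← h.qr, conjTranspose_conjTranspose]

theorem IsScheme.conjTranspose_C_mul_inv (h : IsScheme Hd Hj S V F C Fhat W1 W2 W2Q) :
    Cᴴ * (Cᴴ)⁻¹ = 1 ∧ (Cᴴ)⁻¹ * Cᴴ = 1 := by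
  have hu : IsUnit (Cᴴ).det := by
    rw [det_conjTranspose]
    exact ((isUnit_iff_isUnit_det C).mp h.C_invertible).star
  exact ⟨Matrix.mul_nonsing_inv _ hu, Matrix.nonsing_inv_mul _ hu⟩

theorem IsScheme.conjTranspose_F_mul_eq_zero (h : IsScheme Hd Hj S V F C Fhat W1 W2 W2Q) {k : ℕ}
    {X : Matrix (Fin nt) (Fin k) ℂ} (hX : Hd * X = 0) : Fᴴ * X = 0 := by
  rw [h.channel_eq, Matrix.mul_assoc] at hX
  rw [← Matrix.one_mul (Fᴴ * X), ← h.conjTranspose_C_mul_inv.2, Matrix.mul_assoc, hX,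
    Matrix.mul_zero]

/-- Here `Gᴴ` is `(Vᴴ Hd B)ᴴ` times the inverse of the Gram matrix of `C V`, which is positive
definite because `C` is invertible and `V` has orthonormal columns. -/
theorem IsScheme.isUnit_receiveFilter (h : IsScheme Hd Hj S V F C Fhat W1 W2 W2Q)
    {B : Matrix (Fin nt) (Fin (nr - nj)) ℂ} (hB : IsUnit (Vᴴ * Hd * B)) :
    IsUnit (receiveFilter B F C V) := by
  have h1 : Vᴴ * Cᴴ * ((Cᴴ)⁻¹ * V) = 1 := by
    rw [Matrix.mul_assoc, ← Matrix.mul_assoc Cᴴ, h.conjTranspose_C_mul_inv.1, Matrix.one_mul]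
    exact h.V_unitary
  have h2 : (Vᴴ * Cᴴ * C * V).PosDef := by
    have := posDef_mul_conjTranspose h1
    rwa [conjTranspose_mul, conjTranspose_conjTranspose, conjTranspose_conjTranspose,
      ← Matrix.mul_assoc] at this
  have h3 : Bᴴ * F * C * V = (Vᴴ * Hd * B)ᴴ := by
    rw [conjTranspose_mul, conjTranspose_mul, h.qr, conjTranspose_conjTranspose]
    simp only [Matrix.mul_assoc]
  rw [receiveFilter, h3]
  refine IsUnit.star (IsUnit.mul (IsUnit.star hB) ?_)
  exact (isUnit_nonsing_inv_iff).mpr h2.isUnit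

theorem IsScheme.effectiveChannel_mul_proj (h : IsScheme Hd Hj S V F C Fhat W1 W2 W2Q)
    (G : Matrix (Fin (nr - nj)) (Fin (nr - nj)) ℂ) :
    Gᴴ * Vᴴ * Hd * (F * Fᴴ) = Gᴴ * Vᴴ * Hd := by
  rw [h.channel_eq, Matrix.mul_assoc (Gᴴ * Vᴴ), Matrix.mul_assoc Cᴴ, ← Matrix.mul_assoc Fᴴ,
    h.F_unitary, Matrix.one_mul]

theorem IsScheme.exists_effectiveChannel_rightInverse
    (h : IsScheme Hd Hj S V F C Fhat W1 W2 W2Q)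
    {G : Matrix (Fin (nr - nj)) (Fin (nr - nj)) ℂ} (hG : IsUnit G) :
    ∃ R : Matrix (Fin nt) (Fin (nr - nj)) ℂ, Gᴴ * Vᴴ * Hd * R = 1 := by
  have hGd : Gᴴ * (Gᴴ)⁻¹ = 1 := Matrix.mul_nonsing_inv _ (by
    rw [det_conjTranspose]
    exact ((isUnit_iff_isUnit_det G).mp hG).star)
  have h1 : Hd * (F * (Cᴴ)⁻¹) = 1 := by
    rw [h.channel_eq, Matrix.mul_assoc, ← Matrix.mul_assoc Fᴴ, h.F_unitary, Matrix.one_mul,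
      h.conjTranspose_C_mul_inv.1]
  refine ⟨F * (Cᴴ)⁻¹ * (V * (Gᴴ)⁻¹), ?_⟩
  rw [Matrix.mul_assoc (Gᴴ * Vᴴ), ← Matrix.mul_assoc Hd, h1, Matrix.one_mul, Matrix.mul_assoc Gᴴ,
    ← Matrix.mul_assoc Vᴴ, h.V_unitary, Matrix.one_mul, hGd]

/-- The effective channel `Z` satisfies `Z F Fᴴ = Z`. Hence `W₀ᴴ R` is a right inverse of `Z W₀`
whenever `R` is one of `Z`, and congruence by `Z W₀` preserves definiteness. -/
theorem IsScheme.posDef_effectiveSignal (h : IsScheme Hd Hj S V F C Fhat W1 W2 W2Q)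
    {G : Matrix (Fin (nr - nj)) (Fin (nr - nj)) ℂ} (hG : IsUnit G)
    {K₀ : Matrix (Fin nr) (Fin nr) ℂ} (hK₀ : K₀.PosDef) {W₀ : Matrix (Fin nt) (Fin nr) ℂ}
    (hW₀ : W₀ * W₀ᴴ = F * Fᴴ) :
    ((Gᴴ * Vᴴ * Hd) * (W₀ * K₀ * W₀ᴴ) * (Gᴴ * Vᴴ * Hd)ᴴ).PosDef := by
  obtain ⟨R, hR⟩ := h.exists_effectiveChannel_rightInverse hG
  have h1 : Gᴴ * Vᴴ * Hd * W₀ * (W₀ᴴ * R) = 1 := by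
    rw [Matrix.mul_assoc _ W₀, ← Matrix.mul_assoc W₀, hW₀, ← Matrix.mul_assoc,
      h.effectiveChannel_mul_proj, hR]
  have := posDef_mul_mul_conjTranspose hK₀ h1
  rw [conjTranspose_mul] at this
  simpa only [Matrix.mul_assoc] using this

/-- The projection `1 - F Fᴴ` fixes the columns of `X`, so `He (1 - F Fᴴ)` has the right inverse
`X`; the noise covariance is the Gram matrix of its rows. -/
theorem IsScheme.posDef_eveNoise (h : IsScheme Hd Hj S V F C Fhat W1 W2 W2Q)
    (hX : ∃ X : Matrix (Fin nt) (Fin ne) ℂ, Hd * X = 0 ∧ He * X = 1) :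
    (He * (1 - F * Fᴴ) * Heᴴ).PosDef := by
  obtain ⟨X, hX0, hX1⟩ := hX
  have h1 : He * (1 - F * Fᴴ) * X = 1 := by
    rw [Matrix.mul_assoc, Matrix.sub_mul, Matrix.mul_assoc F, h.conjTranspose_F_mul_eq_zero hX0,
      Matrix.mul_zero, sub_zero, Matrix.one_mul, hX1]
  have h2 : (1 - F * Fᴴ) * (1 - F * Fᴴ)ᴴ = 1 - F * Fᴴ := by
    have : F * Fᴴ * (F * Fᴴ) = F * Fᴴ := by
      rw [Matrix.mul_assoc, ← Matrix.mul_assoc Fᴴ, h.F_unitary, Matrix.one_mul]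
    rw [conjTranspose_sub, conjTranspose_one, conjTranspose_mul, conjTranspose_conjTranspose,
      Matrix.mul_sub, Matrix.mul_one, Matrix.sub_mul, Matrix.one_mul, this, sub_self, sub_zero]
  have := posDef_mul_conjTranspose h1
  rwa [conjTranspose_mul, Matrix.mul_assoc, ← Matrix.mul_assoc _ _ Heᴴ, h2,
    ← Matrix.mul_assoc] at this

theorem IsScheme.perfect_noise (hrt : nr < nt) (h : IsScheme Hd Hj S V F C Fhat W1 W2 W2Q) (P : ℝ) :
    W2 P * (W2 P)ᴴ = 1 - F * Fᴴ :=
  h.F_unitary.add_compl hrt (h.W2_unitary P) (h.conjTranspose_F_mul_eq_zero (h.W2_null P))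

theorem IsScheme.perfect_proj (hrt : nr < nt) (h : IsScheme Hd Hj S V F C Fhat W1 W2 W2Q) (P : ℝ) :
    W1 P * (W1 P)ᴴ = F * Fᴴ := by
  have h1 := (h.W1_unitary P).add_compl hrt (h.W2_unitary P) (h.W1_orth_W2 P)
  rw [h.perfect_noise hrt] at h1
  exact (sub_right_injective h1).symm

theorem IsScheme.Fhat_unitary (hS : ∀ P, IsSpherePackingCodebook (S P))
    (h : IsScheme Hd Hj S V F C Fhat W1 W2 W2Q) (P : ℝ) : IsTruncatedUnitary (Fhat P) := by
  obtain ⟨i, hi, -⟩ := h.quantization P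
  rw [hi]
  exact (hS P).truncatedUnitary i

theorem IsScheme.quantized_noise (hrt : nr < nt) (hS : ∀ P, IsSpherePackingCodebook (S P))
    (h : IsScheme Hd Hj S V F C Fhat W1 W2 W2Q) (P : ℝ) :
    W2Q P * (W2Q P)ᴴ = 1 - Fhat P * (Fhat P)ᴴ :=
  (h.Fhat_unitary hS P).add_compl hrt (h.W2Q_unitary P) (h.W2Q_null P)

/-- The leaked artificial noise, written as a Gram matrix. -/
theorem IsScheme.leakage_eq (hrt : nr < nt) (hS : ∀ P, IsSpherePackingCodebook (S P))
    (h : IsScheme Hd Hj S V F C Fhat W1 W2 W2Q)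
    (G : Matrix (Fin (nr - nj)) (Fin (nr - nj)) ℂ) {P : ℝ} (hP : 0 ≤ P) :
    (P : ℂ) • ((Gᴴ * Vᴴ * Hd) * (W2Q P * (W2Q P)ᴴ) * (Gᴴ * Vᴴ * Hd)ᴴ) =
      (Gᴴ * Vᴴ * Cᴴ) *
        ((((√P : ℝ) : ℂ) • ((F * Fᴴ - Fhat P * (Fhat P)ᴴ) * F))ᴴ *
          (((√P : ℝ) : ℂ) • ((F * Fᴴ - Fhat P * (Fhat P)ᴴ) * F))) * (Gᴴ * Vᴴ * Cᴴ)ᴴ := by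
  have hZ : Gᴴ * Vᴴ * Hd = (Gᴴ * Vᴴ * Cᴴ) * Fᴴ := by rw [h.channel_eq, ← Matrix.mul_assoc]
  have hpp : Fhat P * (Fhat P)ᴴ * (Fhat P * (Fhat P)ᴴ) = Fhat P * (Fhat P)ᴴ := by
    rw [Matrix.mul_assoc, ← Matrix.mul_assoc (Fhat P)ᴴ, h.Fhat_unitary hS P, Matrix.one_mul]
  -- This identifies the part of `F` reached by the artificial noise with a quantity controlled by
  -- the chordal distance.
  have hY : (F * Fᴴ - Fhat P * (Fhat P)ᴴ) * F = (1 - Fhat P * (Fhat P)ᴴ) * F := by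
    rw [Matrix.sub_mul, Matrix.mul_assoc F, h.F_unitary, Matrix.mul_one, Matrix.sub_mul,
      Matrix.one_mul]
  have hH : (1 - Fhat P * (Fhat P)ᴴ)ᴴ = 1 - Fhat P * (Fhat P)ᴴ := by simp
  have hI : (1 - Fhat P * (Fhat P)ᴴ) * (1 - Fhat P * (Fhat P)ᴴ) = 1 - Fhat P * (Fhat P)ᴴ := by
    rw [Matrix.mul_sub, Matrix.mul_one, Matrix.sub_mul, hpp, Matrix.one_mul, sub_self, sub_zero]
  have hsq : star ((√P : ℝ) : ℂ) * ((√P : ℝ) : ℂ) = (P : ℂ) := by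
    rw [Complex.star_def, Complex.conj_ofReal, ← Complex.ofReal_mul, Real.mul_self_sqrt hP]
  rw [hY, hZ, h.quantized_noise hrt hS, conjTranspose_smul, Matrix.mul_smul, Matrix.smul_mul,
    smul_smul, mul_comm, hsq, Matrix.mul_smul, Matrix.smul_mul, conjTranspose_mul (1 - _) F, hH,
    conjTranspose_mul _ Fᴴ, conjTranspose_conjTranspose]
  congr 1
  rw [Matrix.mul_assoc Fᴴ, ← Matrix.mul_assoc (1 - _) (1 - _) F, hI]
  simp only [Matrix.mul_assoc]

/-- Only the projections converge: a codeword is determined by its chordal distances up to a unitary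
change of basis, so `Fhat` itself may have no limit. -/
theorem IsScheme.tendsto_Fhat_proj (hrt : nr < nt) (hr : 0 < nr)
    (hS : ∀ P, IsSpherePackingCodebook (S P)) (h : IsScheme Hd Hj S V F C Fhat W1 W2 W2Q) {ε : ℝ}
    (hε : 0 ≤ ε) (hNf : FeedbackScaling nt nr ε Nf) :
    Tendsto (fun P => Fhat P * (Fhat P)ᴴ) atTop (𝓝 (F * Fᴴ)) := by
  obtain ⟨D, hD, hdist⟩ := hNf.exists_chordalDist_le hrt hr hε hS
  refine tendsto_pi_nhds.mpr fun i => tendsto_pi_nhds.mpr fun j => ?_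
  rw [tendsto_iff_norm_sub_tendsto_zero]
  have hlim : Tendsto (fun P : ℝ => 2 * (D / P ^ ((1 + ε) / 2))) atTop (𝓝 0) := by
    simpa using ((tendsto_rpow_atTop (show 0 < (1 + ε) / 2 by linarith)).const_div_atTop D).const_mul 2
  refine squeeze_zero' (Eventually.of_forall fun _ => norm_nonneg _) ?_ hlim
  filter_upwards [hdist] with P hP
  exact (entry_le_chordalDist _ _ i j).trans
    (mul_le_mul_of_nonneg_left (hP F _ h.F_unitary (h.quantization P)) two_pos.le)

/-- The exponents combine to `√P * P^(-(1+ε)/2) = P^(-ε/2)`, so `ε = 0` is the threshold at which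
the scaled error is still bounded. -/
theorem IsScheme.quantizationError_le (hrt : nr < nt) (hr : 0 < nr)
    (hS : ∀ P, IsSpherePackingCodebook (S P)) (h : IsScheme Hd Hj S V F C Fhat W1 W2 W2Q) {ε : ℝ}
    (hε : 0 ≤ ε) (hNf : FeedbackScaling nt nr ε Nf) :
    ∃ D : ℝ, 0 < D ∧ ∀ᶠ P : ℝ in atTop, ∀ i j,
      ‖(((√P : ℝ) : ℂ) • ((F * Fᴴ - Fhat P * (Fhat P)ᴴ) * F)) i j‖ ≤ D * P ^ (-(ε / 2)) := by
  obtain ⟨D, hD, hdist⟩ := hNf.exists_chordalDist_le hrt hr hε hS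
  refine ⟨nt * (2 * D), by have : (0 : ℝ) < nt := by exact_mod_cast hr.trans hrt
                           positivity, ?_⟩
  filter_upwards [hdist, eventually_gt_atTop 0] with P hP hP0 i j
  have h1 : ∀ k, ‖(F * Fᴴ - Fhat P * (Fhat P)ᴴ) i k * F k j‖ ≤ 2 * (D / P ^ ((1 + ε) / 2)) := by
    intro k
    rw [norm_mul]
    refine (mul_le_of_le_one_right (norm_nonneg _) (h.F_unitary.entry_le_one k j)).trans ?_
    rw [Matrix.sub_apply, norm_sub_rev, ← Matrix.sub_apply]
    exact (entry_le_chordalDist _ _ i k).trans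
      (mul_le_mul_of_nonneg_left (hP F _ h.F_unitary (h.quantization P)) two_pos.le)
  have h2 : ‖((F * Fᴴ - Fhat P * (Fhat P)ᴴ) * F) i j‖ ≤ nt * (2 * (D / P ^ ((1 + ε) / 2))) := by
    rw [Matrix.mul_apply]
    refine (norm_sum_le _ _).trans ((Finset.sum_le_sum fun k _ => h1 k).trans ?_)
    simp
  have h3 : √P / P ^ ((1 + ε) / 2) = P ^ (-(ε / 2)) := by
    rw [Real.sqrt_eq_rpow, ← Real.rpow_sub hP0]
    congr 1
    ring
  rw [Matrix.smul_apply, norm_smul, Complex.norm_real, Real.norm_of_nonneg (Real.sqrt_nonneg _)]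
  refine (mul_le_mul_of_nonneg_left h2 (Real.sqrt_nonneg _)).trans (le_of_eq ?_)
  rw [← h3]
  ring

/-- The high-power limits of all the objects of the scheme along an ultrafilter. -/
theorem IsScheme.exists_limits (hrt : nr < nt) (hjr : nj < nr)
    (hS : ∀ P, IsSpherePackingCodebook (S P)) (h : IsScheme Hd Hj S V F C Fhat W1 W2 W2Q)
    {ρ σ : ℝ} (σe : ℝ) (hρ0 : 0 < ρ) (hρ1 : ρ < 1) (hσ : 0 < σ)
    {B : Matrix (Fin nt) (Fin (nr - nj)) ℂ} (hB : IsUnit (Vᴴ * Hd * B))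
    (hX : ∃ X : Matrix (Fin nt) (Fin ne) ℂ, Hd * X = 0 ∧ He * X = 1)
    {K : ℝ → Matrix (Fin nr) (Fin nr) ℂ} {c₀ c₁ : ℝ} (hc₀ : 0 < c₀)
    (hK : ∀ᶠ P : ℝ in atTop,
      (K P - ((c₀ * P : ℝ) : ℂ) • (1 : Matrix (Fin nr) (Fin nr) ℂ)).PosSemidef ∧
      (((c₁ * P : ℝ) : ℂ) • (1 : Matrix (Fin nr) (Fin nr) ℂ) - K P).PosSemidef)
    {ε : ℝ} (hε : 0 ≤ ε) (hNf : FeedbackScaling nt nr ε Nf)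
    {U : Ultrafilter ℝ} (hU : (U : Filter ℝ) ≤ atTop) :
    ∃ (K₀ : Matrix (Fin nr) (Fin nr) ℂ) (W₀ F₀ : Matrix (Fin nt) (Fin nr) ℂ)
      (E : Matrix (Fin (nr - nj)) (Fin (nr - nj)) ℂ),
      Tendsto (fun P : ℝ => ((P⁻¹ : ℝ) : ℂ) • K P) U (𝓝 K₀) ∧
      Tendsto W1 U (𝓝 W₀) ∧ Tendsto Fhat U (𝓝 F₀) ∧
      W₀ * W₀ᴴ = F * Fᴴ ∧ F₀ * F₀ᴴ = F * Fᴴ ∧ (0 < ε → E = 0) ∧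
      Tendsto (fun P => ratePerfect ρ σ σe P (K P) Hd He V (receiveFilter B F C V) (W1 P) (W2 P)
          - ((nr : ℝ) - nj) * Real.logb 2 P) U
        (𝓝 (rateLimit ρ σ nr ((receiveFilter B F C V)ᴴ * Vᴴ * Hd) He (receiveFilter B F C V)
          (W₀ * K₀ * W₀ᴴ) (He * (1 - F * Fᴴ) * Heᴴ) 0)) ∧
      Tendsto (fun P => rateQuantized ρ σ σe P (K P) Hd He V (receiveFilter B F C V) (Fhat P)
          (W2Q P) - ((nr : ℝ) - nj) * Real.logb 2 P) U
        (𝓝 (rateLimit ρ σ nr ((receiveFilter B F C V)ᴴ * Vᴴ * Hd) He (receiveFilter B F C V)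
          (F₀ * K₀ * F₀ᴴ) (He * (1 - F * Fᴴ) * Heᴴ) E)) := by
  have hr : 0 < nr := by omega
  set G := receiveFilter B F C V with hGdef
  have hGu : IsUnit G := h.isUnit_receiveFilter hB
  have hGG : (Gᴴ * G).PosDef := by
    have := posDef_mul_conjTranspose (A := Gᴴ) (R := (Gᴴ)⁻¹) (Matrix.mul_nonsing_inv _ (by
      rw [det_conjTranspose]
      exact ((isUnit_iff_isUnit_det G).mp hGu).star))
    rwa [conjTranspose_conjTranspose] at this
  have hQ₀ := h.posDef_eveNoise hX
  have hds : ((nr - nj : ℕ) : ℝ) = (nr : ℝ) - nj := Nat.cast_sub hjr.le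
  -- the normalized covariance
  have hKn : ∀ᶠ P : ℝ in atTop, (((P⁻¹ : ℝ) : ℂ) • K P - (c₀ : ℂ) • 1).PosSemidef ∧
      ((c₁ : ℂ) • (1 : Matrix (Fin nr) (Fin nr) ℂ) - ((P⁻¹ : ℝ) : ℂ) • K P).PosSemidef := by
    filter_upwards [hK, eventually_gt_atTop 0] with P hP hP0
    have hP' : (P : ℂ) ≠ 0 := by exact_mod_cast hP0.ne'
    have hc : ∀ c : ℝ, ((P⁻¹ : ℝ) : ℂ) * ((c * P : ℝ) : ℂ) = c := fun c => by
      push_cast; field_simp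
    have h1 := posSemidef_ofReal_smul hP.1 (inv_nonneg.mpr hP0.le)
    have h2 := posSemidef_ofReal_smul hP.2 (inv_nonneg.mpr hP0.le)
    rw [smul_sub, smul_smul, hc] at h1 h2
    exact ⟨h1, h2⟩
  obtain ⟨K₀, hK₀⟩ := exists_tendsto_of_entry_le (U := U)
    (A := fun P : ℝ => ((P⁻¹ : ℝ) : ℂ) • K P) (r := c₁) (by
      filter_upwards [hU hKn] with P hP
      refine entry_le_of_posSemidef ?_ hP.2
      have := hP.1.add (posSemidef_ofReal_smul PosSemidef.one hc₀.le)
      rwa [sub_add_cancel] at this)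
  -- The lower bound `c₀` passes to the limit and keeps the signal from losing rank.
  have hK₀pd : K₀.PosDef := by
    have h1 := posSemidef_of_tendsto (hK₀.sub_const ((c₀ : ℂ) • (1 : Matrix (Fin nr) (Fin nr) ℂ)))
      (hU (hKn.mono fun P hP => hP.1))
    have := PosDef.posSemidef_add h1 (posDef_ofReal_smul PosDef.one hc₀)
    rwa [sub_add_cancel] at this
  obtain ⟨W₀, hW₀⟩ := exists_tendsto_of_entry_le (U := U) (A := W1) (r := 1)
    (Eventually.of_forall fun P => (h.W1_unitary P).entry_le_one)
  obtain ⟨F₀, hF₀⟩ := exists_tendsto_of_entry_le (U := U) (A := Fhat) (r := 1)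
    (Eventually.of_forall fun P => (h.Fhat_unitary hS P).entry_le_one)
  have hW₀p : W₀ * W₀ᴴ = F * Fᴴ := by
    refine tendsto_nhds_unique (tendsto_matrix_mul hW₀ (tendsto_matrix_conjTranspose hW₀)) ?_
    simp only [h.perfect_proj hrt]
    exact tendsto_const_nhds
  have hFproj := (h.tendsto_Fhat_proj hrt hr hS hε hNf).mono_left hU
  have hF₀p : F₀ * F₀ᴴ = F * Fᴴ :=
    tendsto_nhds_unique (tendsto_matrix_mul hF₀ (tendsto_matrix_conjTranspose hF₀)) hFproj
  -- the leaked noise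
  obtain ⟨D, hD, hYle⟩ := h.quantizationError_le hrt hr hS hε hNf
  obtain ⟨Y₀, hY₀⟩ := exists_tendsto_of_entry_le (U := U)
    (A := fun P : ℝ => ((√P : ℝ) : ℂ) • ((F * Fᴴ - Fhat P * (Fhat P)ᴴ) * F)) (r := D) (by
      filter_upwards [hU hYle, hU (eventually_ge_atTop 1)] with P hP hP1 i j
      exact (hP i j).trans (mul_le_of_le_one_right hD.le
        (Real.rpow_le_one_of_one_le_of_nonpos hP1 (by linarith))))
  have hY₀0 : 0 < ε → Y₀ = 0 := by
    intro hε0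
    refine tendsto_nhds_unique hY₀ (tendsto_pi_nhds.mpr fun i => tendsto_pi_nhds.mpr fun j => ?_)
    have hlim : Tendsto (fun P : ℝ => D * P ^ (-(ε / 2))) U (𝓝 0) := by
      simpa using ((tendsto_rpow_neg_atTop (half_pos hε0)).const_mul D).mono_left hU
    exact squeeze_zero_norm' (hU (hYle.mono fun P hP => hP i j)) hlim
  set X₀ := Gᴴ * Vᴴ * Cᴴ with hX₀
  have hE : Tendsto (fun P : ℝ => (P : ℂ) •
      ((Gᴴ * Vᴴ * Hd) * (W2Q P * (W2Q P)ᴴ) * (Gᴴ * Vᴴ * Hd)ᴴ)) U (𝓝 (X₀ * (Y₀ᴴ * Y₀) * X₀ᴴ)) := by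
    have h1 := tendsto_matrix_mul (tendsto_matrix_mul (tendsto_const_nhds (x := X₀))
      (tendsto_matrix_mul (tendsto_matrix_conjTranspose hY₀) hY₀)) (tendsto_const_nhds (x := X₀ᴴ))
    refine h1.congr' ?_
    filter_upwards [hU (eventually_ge_atTop 0)] with P hP
    exact (h.leakage_eq hrt hS G hP).symm
  have hE₀ : (X₀ * (Y₀ᴴ * Y₀) * X₀ᴴ).PosSemidef :=
    (posSemidef_conjTranspose_mul_self Y₀).mul_mul_conjTranspose_same X₀
  refine ⟨K₀, W₀, F₀, X₀ * (Y₀ᴴ * Y₀) * X₀ᴴ, hK₀, hW₀, hF₀, hW₀p, hF₀p, fun hε0 => ?_, ?_, ?_⟩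
  · rw [hY₀0 hε0]; simp
  · simp only [ratePerfect_eq_rateQuantized (h.W2_null _)]
    rw [← hds]
    refine tendsto_rateQuantized_sub hU hrt hρ0 hρ1 hσ hK₀ hW₀ ?_ hK₀pd.posSemidef hQ₀ ?_
      PosSemidef.zero hGG (h.posDef_effectiveSignal hGu hK₀pd hW₀p)
    · simp only [h.perfect_noise hrt]
      exact tendsto_const_nhds
    · have : ∀ P, Gᴴ * Vᴴ * Hd * (W2 P * (W2 P)ᴴ) = 0 := fun P => by
        rw [← Matrix.mul_assoc, Matrix.mul_assoc _ Hd, h.W2_null, Matrix.mul_zero, Matrix.zero_mul]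
      simp only [this, Matrix.zero_mul, smul_zero]
      exact tendsto_const_nhds
  · rw [← hds]
    refine tendsto_rateQuantized_sub hU hrt hρ0 hρ1 hσ hK₀ hF₀ ?_ hK₀pd.posSemidef hQ₀ hE
      hE₀ hGG (h.posDef_effectiveSignal hGu hK₀pd hF₀p)
    simp only [h.quantized_noise hrt hS]
    exact hFproj.const_sub 1

/-- Two bases of one subspace agree if they are matched. -/
theorem eq_of_matched {m n : ℕ} {F₀ W₀ : Matrix (Fin m) (Fin n) ℂ} (hW : IsTruncatedUnitary W₀)
    (hp : F₀ * F₀ᴴ = W₀ * W₀ᴴ) (hA : (F₀ᴴ * W₀).PosSemidef) : W₀ = F₀ := by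
  have hsq : (F₀ᴴ * W₀)ᴴ * (F₀ᴴ * W₀) = 1 := by
    rw [conjTranspose_mul, conjTranspose_conjTranspose, Matrix.mul_assoc, ← Matrix.mul_assoc F₀, hp,
      Matrix.mul_assoc W₀, hW, Matrix.mul_one, hW]
  rw [hA.1] at hsq
  set A := F₀ᴴ * W₀ with hAdef
  -- A positive semidefinite `A` with `A² = 1` is the identity, since `(A + 1)(A - 1) = 0` and `A +
  -- 1` is invertible.
  have hpd : (A + 1).PosDef := PosDef.posSemidef_add hA PosDef.one
  have h1 : (A + 1) * (A - 1) = 0 := by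
    rw [Matrix.mul_sub, Matrix.mul_one, Matrix.add_mul, Matrix.one_mul, hsq]
    abel
  have h2 : A = 1 := sub_eq_zero.mp (hpd.isUnit.mul_right_eq_zero.mp h1)
  calc W₀ = W₀ * W₀ᴴ * W₀ := by rw [Matrix.mul_assoc, hW, Matrix.mul_one]
    _ = F₀ * A := by rw [← hp, Matrix.mul_assoc]
    _ = F₀ := by rw [h2, Matrix.mul_one]

theorem IsScheme.hasSDoF (hrt : nr < nt) (hjr : nj < nr)
    (hS : ∀ P, IsSpherePackingCodebook (S P)) (h : IsScheme Hd Hj S V F C Fhat W1 W2 W2Q)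
    {ρ σ : ℝ} (σe : ℝ) (hρ0 : 0 < ρ) (hρ1 : ρ < 1) (hσ : 0 < σ)
    {B : Matrix (Fin nt) (Fin (nr - nj)) ℂ} (hB : IsUnit (Vᴴ * Hd * B))
    (hX : ∃ X : Matrix (Fin nt) (Fin ne) ℂ, Hd * X = 0 ∧ He * X = 1)
    {K : ℝ → Matrix (Fin nr) (Fin nr) ℂ} {c₀ c₁ : ℝ} (hc₀ : 0 < c₀)
    (hK : ∀ᶠ P : ℝ in atTop,
      (K P - ((c₀ * P : ℝ) : ℂ) • (1 : Matrix (Fin nr) (Fin nr) ℂ)).PosSemidef ∧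
      (((c₁ * P : ℝ) : ℂ) • (1 : Matrix (Fin nr) (Fin nr) ℂ) - K P).PosSemidef)
    {ε : ℝ} (hε : 0 ≤ ε) (hNf : FeedbackScaling nt nr ε Nf) :
    HasSDoF (fun P => ratePerfect ρ σ σe P (K P) Hd He V
      (receiveFilter B F C V) (W1 P) (W2 P)) ((nr : ℝ) - nj) ∧
    HasSDoF (fun P => rateQuantized ρ σ σe P (K P) Hd He V
      (receiveFilter B F C V) (Fhat P) (W2Q P)) ((nr : ℝ) - nj) := by
  constructor <;> refine HasSDoF.of_ultrafilter fun U hU => ?_ <;>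
  obtain ⟨K₀, W₀, F₀, E, -, -, -, -, -, -, h1, h2⟩ :=
    h.exists_limits hrt hjr hS σe hρ0 hρ1 hσ hB hX hc₀ hK hε hNf hU
  · exact ⟨_, h1⟩
  · exact ⟨_, h2⟩

/-- The logarithmic terms cancel and the leakage limit is zero, so it suffices that the limiting
signal covariances at the transmitter agree. A scalar `K₀` sees only the common projection; in the
matched case positivity passes to `F₀ᴴ W₀`. -/
theorem IsScheme.tendsto_rate_gap (hrt : nr < nt) (hjr : nj < nr)
    (hS : ∀ P, IsSpherePackingCodebook (S P)) (h : IsScheme Hd Hj S V F C Fhat W1 W2 W2Q)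
    {ρ σ : ℝ} (σe : ℝ) (hρ0 : 0 < ρ) (hρ1 : ρ < 1) (hσ : 0 < σ)
    {B : Matrix (Fin nt) (Fin (nr - nj)) ℂ} (hB : IsUnit (Vᴴ * Hd * B))
    (hX : ∃ X : Matrix (Fin nt) (Fin ne) ℂ, Hd * X = 0 ∧ He * X = 1)
    {K : ℝ → Matrix (Fin nr) (Fin nr) ℂ} {c₀ c₁ : ℝ} (hc₀ : 0 < c₀)
    (hK : ∀ᶠ P : ℝ in atTop,
      (K P - ((c₀ * P : ℝ) : ℂ) • (1 : Matrix (Fin nr) (Fin nr) ℂ)).PosSemidef ∧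
      (((c₁ * P : ℝ) : ℂ) • (1 : Matrix (Fin nr) (Fin nr) ℂ) - K P).PosSemidef)
    {ε : ℝ} (hε : 0 < ε) (hNf : FeedbackScaling nt nr ε Nf)
    (hcov : (∃ c : ℝ, Tendsto (fun P : ℝ => ((P⁻¹ : ℝ) : ℂ) • K P) atTop
        (𝓝 ((c : ℂ) • (1 : Matrix (Fin nr) (Fin nr) ℂ)))) ∨
      (∀ᶠ P : ℝ in atTop, ((Fhat P)ᴴ * W1 P).PosSemidef)) :
    Tendsto (fun P =>
      ratePerfect ρ σ σe P (K P) Hd He V (receiveFilter B F C V) (W1 P) (W2 P)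
      - rateQuantized ρ σ σe P (K P) Hd He V (receiveFilter B F C V) (Fhat P) (W2Q P))
      atTop (𝓝 0) := by
  refine (tendsto_iff_ultrafilter _ _ _).mpr fun U hU => ?_
  obtain ⟨K₀, W₀, F₀, E, hK₀, hW₀, hF₀, hW₀p, hF₀p, hE, h1, h2⟩ :=
    h.exists_limits hrt hjr hS σe hρ0 hρ1 hσ hB hX hc₀ hK hε.le hNf hU
  have hM : W₀ * K₀ * W₀ᴴ = F₀ * K₀ * F₀ᴴ := by
    rcases hcov with ⟨c, hc⟩ | hmatch
    · have : K₀ = (c : ℂ) • 1 := tendsto_nhds_unique hK₀ (hc.mono_left hU)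
      rw [this]
      simp only [Matrix.mul_smul, Matrix.mul_one, Matrix.smul_mul, hW₀p, hF₀p]
    · have hWu : IsTruncatedUnitary W₀ := by
        refine tendsto_nhds_unique (tendsto_matrix_mul (tendsto_matrix_conjTranspose hW₀) hW₀) ?_
        have : ∀ P, (W1 P)ᴴ * W1 P = 1 := h.W1_unitary
        simp only [this]
        exact tendsto_const_nhds
      rw [eq_of_matched hWu (hF₀p.trans hW₀p.symm) (posSemidef_of_tendsto
        (tendsto_matrix_mul (tendsto_matrix_conjTranspose hF₀) hW₀) (hU hmatch))]
  rw [hM] at h1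
  rw [hE hε] at h2
  simpa using h1.sub h2

end Scheme

end SecureMIMO

/-! ### The main theorem -/

theorem theorem2 {Ω : Type*} [MeasurableSpace Ω] (Pr : Measure Ω) [IsProbabilityMeasure Pr]
    (nt nr nj ne : ℕ) (hrt : nr < nt) (hjr : nj < nr) (hne : ne ≤ nt - nr)
    (Hd : Ω → Matrix (Fin nr) (Fin nt) ℂ) (Hj : Ω → Matrix (Fin nr) (Fin nj) ℂ)
    (He : Ω → Matrix (Fin ne) (Fin nt) ℂ)
    (hH : SecureMIMO.IIDContinuousChannels Pr Hd Hj He)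
    (ρ σ σe : ℝ) (hρ0 : 0 < ρ) (hρ1 : ρ < 1) (hσ : 0 < σ) (hσe : 0 < σe)
    (B : Matrix (Fin nt) (Fin (nr - nj)) ℂ) (hB : SecureMIMO.IsTruncatedUnitary B)
    (K : ℝ → Matrix (Fin nr) (Fin nr) ℂ) (c₀ c₁ : ℝ)
    (hc₀ : c₀ ∈ Set.Ioc (0 : ℝ) (1 / nr)) (hc₁ : c₁ ∈ Set.Ioc (0 : ℝ) (1 / nr))
    (hK : ∀ᶠ P : ℝ in atTop,
      (K P - ((c₀ * P : ℝ) : ℂ) • (1 : Matrix (Fin nr) (Fin nr) ℂ)).PosSemidef ∧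
      (((c₁ * P : ℝ) : ℂ) • (1 : Matrix (Fin nr) (Fin nr) ℂ) - K P).PosSemidef)
    (Nf : ℝ → ℕ) (S : (P : ℝ) → Fin (2 ^ Nf P) → Matrix (Fin nt) (Fin nr) ℂ)
    (hS : ∀ P, SecureMIMO.IsSpherePackingCodebook (S P)) :
    -- first part: the full secure degrees of freedom are kept
    (SecureMIMO.FeedbackScaling nt nr 0 Nf →
      ∀ᵐ ω ∂Pr, ∀ V F C Fhat W1 W2 W2Q,
        SecureMIMO.IsScheme (Hd ω) (Hj ω) S V F C Fhat W1 W2 W2Q →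
        SecureMIMO.HasSDoF (fun P => SecureMIMO.ratePerfect ρ σ σe P (K P) (Hd ω) (He ω) V
          (SecureMIMO.receiveFilter B F C V) (W1 P) (W2 P)) ((nr : ℝ) - nj) ∧
        SecureMIMO.HasSDoF (fun P => SecureMIMO.rateQuantized ρ σ σe P (K P) (Hd ω) (He ω) V
          (SecureMIMO.receiveFilter B F C V) (Fhat P) (W2Q P)) ((nr : ℝ) - nj)) ∧
    -- second part: moreover, the rate gap vanishes
    (∀ ε : ℝ, 0 < ε → SecureMIMO.FeedbackScaling nt nr ε Nf →
      ∀ᵐ ω ∂Pr, ∀ V F C Fhat W1 W2 W2Q,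
        SecureMIMO.IsScheme (Hd ω) (Hj ω) S V F C Fhat W1 W2 W2Q →
        SecureMIMO.HasSDoF (fun P => SecureMIMO.ratePerfect ρ σ σe P (K P) (Hd ω) (He ω) V
          (SecureMIMO.receiveFilter B F C V) (W1 P) (W2 P)) ((nr : ℝ) - nj) ∧
        SecureMIMO.HasSDoF (fun P => SecureMIMO.rateQuantized ρ σ σe P (K P) (Hd ω) (He ω) V
          (SecureMIMO.receiveFilter B F C V) (Fhat P) (W2Q P)) ((nr : ℝ) - nj) ∧
        -- the covariance is asymptotically isotropic, or `W1` is the basis matched to `Fhat`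
        (((∃ c : ℝ, Tendsto (fun P : ℝ => ((P⁻¹ : ℝ) : ℂ) • K P) atTop
              (𝓝 ((c : ℂ) • (1 : Matrix (Fin nr) (Fin nr) ℂ)))) ∨
            (∀ᶠ P : ℝ in atTop, ((Fhat P)ᴴ * W1 P).PosSemidef)) →
          Tendsto (fun P =>
              SecureMIMO.ratePerfect ρ σ σe P (K P) (Hd ω) (He ω) V
                (SecureMIMO.receiveFilter B F C V) (W1 P) (W2 P)
              - SecureMIMO.rateQuantized ρ σ σe P (K P) (Hd ω) (He ω) V
                (SecureMIMO.receiveFilter B F C V) (Fhat P) (W2Q P))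
            atTop (𝓝 0))) := by
  constructor
  · intro hNf
    -- The exceptional null set comes from the channels and `B` alone, so it serves all choices of
    -- filters and precoders at once.
    filter_upwards [hH.ae_isUnit_filtered_channel hjr hB, hH.ae_exists_rightInverse hrt hne] with ω hL hR
    intro V F C Fhat W1 W2 W2Q h
    exact h.hasSDoF hrt hjr hS σe hρ0 hρ1 hσ (hL V h.V_unitary h.V_null) hR hc₀.1 hK le_rfl hNf
  · intro ε hε hNf
    filter_upwards [hH.ae_isUnit_filtered_channel hjr hB, hH.ae_exists_rightInverse hrt hne] with ω hL hR
    intro V F C Fhat W1 W2 W2Q h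
    have hV := hL V h.V_unitary h.V_null
    obtain ⟨h1, h2⟩ := h.hasSDoF hrt hjr hS σe hρ0 hρ1 hσ hV hR hc₀.1 hK hε.le hNf
    exact ⟨h1, h2, h.tendsto_rate_gap hrt hjr hS σe hρ0 hρ1 hσ hV hR hc₀.1 hK hε hNf⟩
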